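/- Let $p,q\ge 1$ be integers, $n=p+q$, and let $t_*\in(0,\frac{\pi}{2})$ be given by $\tan^2 t_*=\frac{q}{p}$. Write points of $\mathbb{R}^{n+2}=\mathbb{R}^{p+1}\times\mathbb{R}^{q+1}$ as $(x,y)$ and let $$C_{t_*}=\{(x,y): \|x\|=\cos t_*,\ \|y\|=\sin t_*\}\subset S^{n+1}$$ be the minimal generalized Clifford hypersurface, with unit normal field $N(x,y)=(\tan t_*\,x,\,-\cot t_*\,y)$ in $S^{n+1}$, second fundamental form $B$, and Laplace operator $\Delta$ of the induced metric. Let $\mathcal{L}_{t_*}=\Delta+\|B\|^2+n$ be its Jacobi operator; a Jacobi field is a function $u\in C^2(C_{t_*})$ with $\mathcal{L}_{t_*}u=0$. Then: 1. A function on $C_{t_*}$ is a Jacobi field if and only if it is the restriction to $C_{t_*}$ of a function of the form $$(x,y)\mapsto\sum_{k=1}^{p+1}\sum_{l=1}^{q+1}a^{kl}x_ky_l,\qquad a^{kl}\in\mathbb{R}.$$ 2. The Jacobi fields are generated by the rotations of $\mathbb{R}^{n+2}$ that break the splitting $\mathbb{R}^{p+1}\times\mathbb{R}^{q+1}$. That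 is, a function on $C_{t_*}$ is a Jacobi field if and only if it equals $\langle V,N\rangle$, where $V=\frac{d}{ds}\big|_{s=0}e^{sA}$ is the deformation field of a one-parameter group of rotations $e^{sA}$ whose skew-symmetric generator $A$ maps $\mathbb{R}^{p+1}\times\{0\}$ into $\{0\}\times\mathbb{R}^{q+1}$ and $\{0\}\times\mathbb{R}^{q+1}$ into $\mathbb{R}^{p+1}\times\{0\}$. For an arbitrary skew-symmetric $A$, the function $\langle V,N\rangle$ vanishes identically on $C_{t_*}$ if and only if $A$ maps each of the two factors into itself. 3. The space of Jacobi fields has dimension $(p+1)(q+1)$. -/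

import Mathlib

namespace CliffordJacobi

open scoped InnerProductSpace

noncomputable section

section Submanifold

variable {E : Type*} [NormedAddCommGroup E] [InnerProductSpace ℝ E] [FiniteDimensional ℝ E]

/-- The tangent space at `z` of a submanifold `M` of a Euclidean space `E`: the linear span of the
velocities at `z` of the curves that run in `M`. -/
def tangentSpaceAt (M : Set E) (z : E) : Submodule ℝ E :=
  Submodule.span ℝ
    {v | ∃ γ : ℝ → E, γ 0 = z ∧ (∀ s, γ s ∈ M) ∧ HasDerivAt γ v 0}

/-- The gradient on `M` for the induced metric: the tangent vector at `z` that represents the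
derivative of `u` along `M`. A derivative within `M` is determined by `u` along tangent vectors
only, and the projection removes the rest; values of `u` off `M` play no role. -/
def surfaceGradient (M : Set E) (u : E → ℝ) (z : E) : E :=
  (tangentSpaceAt M z).starProjection (gradientWithin u M z)

/-- The divergence on `M` of a tangential field `X`: the trace over the tangent space of
`v ↦ ∇_v X`, where the Levi-Civita derivative `∇_v X` of the induced metric is the tangential part
of the derivative of `X` in the direction `v`. -/
def surfaceDivergence (M : Set E) (X : E → E) (z : E) : ℝ :=
  LinearMap.trace ℝ (tangentSpaceAt M z)
    (((tangentSpaceAt M z).orthogonalProjectionOnto ∘L fderivWithin ℝ X M z ∘L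
      (tangentSpaceAt M z).subtypeL : tangentSpaceAt M z →L[ℝ] tangentSpaceAt M z) :
      tangentSpaceAt M z →ₗ[ℝ] tangentSpaceAt M z)

/-- The Laplace operator of `M` with its induced metric, `div grad`. -/
def laplaceBeltrami (M : Set E) (u : E → ℝ) (z : E) : ℝ :=
  surfaceDivergence M (surfaceGradient M u) z

/-- The second fundamental form of `M` with respect to the unit normal field `N`. -/
def secondFundamentalForm (M : Set E) (N : E → E) (z v w : E) : ℝ :=
  -⟪fderivWithin ℝ N M z v, w⟫_ℝ

/-- The squared norm `‖B‖²` of the second fundamental form: the sum of the squares of its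
coefficients in an orthonormal basis of the tangent space. -/
def normSqSecondFundamentalForm (M : Set E) (N : E → E) (z : E) : ℝ :=
  ∑ i, ∑ j, secondFundamentalForm M N z
    (stdOrthonormalBasis ℝ (tangentSpaceAt M z) i : E)
    (stdOrthonormalBasis ℝ (tangentSpaceAt M z) j : E) ^ 2

/-- The Jacobi operator `Δ + ‖B‖² + Ric(N, N)` of a hypersurface `M` of the unit sphere `S^{n+1}`
of `E`, with unit normal field `N` in the sphere; there `Ric(N, N) = n`. -/
def jacobiOperator (n : ℕ) (M : Set E) (N : E → E) (u : E → ℝ) (z : E) : ℝ :=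
  laplaceBeltrami M u z + normSqSecondFundamentalForm M N z * u z + n * u z

end Submanifold

/-- `ℝ^{n+2} = ℝ^{p+1} × ℝ^{q+1}`, `n = p + q`, with the Euclidean inner product. -/
abbrev Ambient (p q : ℕ) : Type :=
  WithLp 2 (EuclideanSpace ℝ (Fin (p + 1)) × EuclideanSpace ℝ (Fin (q + 1)))

/-- The generalized Clifford hypersurface `C_t = S^p(cos t) × S^q(sin t)`. -/
def clifford (p q : ℕ) (t : ℝ) : Set (Ambient p q) :=
  {z | ‖z.fst‖ = Real.cos t ∧ ‖z.snd‖ = Real.sin t}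

/-- The unit normal field `N_t = sin t P_x - cos t P_y` of `C_t` in the sphere, where
`P_x = x / cos t` and `P_y = y / sin t` are the unit radial fields of the two factors. -/
def cliffordNormal (p q : ℕ) (t : ℝ) (z : Ambient p q) : Ambient p q :=
  WithLp.toLp 2
    ((Real.sin t / Real.cos t) • z.fst, -((Real.cos t / Real.sin t) • z.snd))

/-- `u` restricts to a Jacobi field of `C_t`: it is twice continuously differentiable on `C_t`
and is annihilated by the Jacobi operator. Only the values of `u` on `C_t` matter. -/
def IsJacobiField (p q : ℕ) (t : ℝ) (u : Ambient p q → ℝ) : Prop :=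
  ContDiffOn ℝ 2 u (clifford p q t) ∧
    ∀ z ∈ clifford p q t,
      jacobiOperator (p + q) (clifford p q t) (cliffordNormal p q t) u z = 0

/-- The function `⟨V, N_t⟩`, where `V` is the deformation field of the one-parameter group
`exp (s A)`; it consists of rotations when `A` is skew-adjoint. -/
def rotationField (p q : ℕ) (t : ℝ) (A : Ambient p q →L[ℝ] Ambient p q) (z : Ambient p q) : ℝ :=
  ⟪deriv (fun s : ℝ => NormedSpace.exp (s • A) z) 0, cliffordNormal p q t z⟫_ℝ

/-- The infinitesimal generator `A` maps each of the two factors of the splitting to itself. -/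
def PreservesSplitting {p q : ℕ} (A : Ambient p q →L[ℝ] Ambient p q) : Prop :=
  (∀ z : Ambient p q, z.snd = 0 → (A z).snd = 0) ∧
    (∀ z : Ambient p q, z.fst = 0 → (A z).fst = 0)

/-- The infinitesimal generator `A` maps each of the two factors of the splitting to the other. -/
def BreaksSplitting {p q : ℕ} (A : Ambient p q →L[ℝ] Ambient p q) : Prop :=
  (∀ z : Ambient p q, z.snd = 0 → (A z).fst = 0) ∧
    (∀ z : Ambient p q, z.fst = 0 → (A z).snd = 0)

end

end CliffordJacobi

namespace CliffordJacobi

open scoped InnerProductSpace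

noncomputable section

section PlaneRotation

variable {E : Type*} [NormedAddCommGroup E] [InnerProductSpace ℝ E]

/-- The skew-symmetric endomorphism `z ↦ ⟪a, z⟫ b - ⟪b, z⟫ a`. -/
def planeRotation (a b : E) : E →L[ℝ] E :=
  InnerProductSpace.rankOne ℝ b a - InnerProductSpace.rankOne ℝ a b

@[simp]
theorem planeRotation_apply (a b z : E) :
    planeRotation a b z = ⟪a, z⟫_ℝ • b - ⟪b, z⟫_ℝ • a := by
  simp [planeRotation]

section Sum

variable {ι : Type*} [Fintype ι]

theorem sum_inner_planeRotation_smul (e : ι → E) (z v : E) :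
    ∑ i, ∑ j, ⟪planeRotation (e i) (e j) z, v⟫_ℝ • planeRotation (e i) (e j) z =
      (2 * ∑ i, ⟪e i, z⟫_ℝ ^ 2) • ∑ i, ⟪e i, v⟫_ℝ • e i -
        (2 * ∑ i, ⟪e i, z⟫_ℝ * ⟪e i, v⟫_ℝ) • ∑ i, ⟪e i, z⟫_ℝ • e i := by
  have h : ∀ i j, ⟪planeRotation (e i) (e j) z, v⟫_ℝ • planeRotation (e i) (e j) z =
      (⟪e i, z⟫_ℝ ^ 2) • (⟪e j, v⟫_ℝ • e j) - (⟪e j, z⟫_ℝ * ⟪e j, v⟫_ℝ) • (⟪e i, z⟫_ℝ • e i)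
      - ((⟪e i, z⟫_ℝ * ⟪e i, v⟫_ℝ) • (⟪e j, z⟫_ℝ • e j) -
        (⟪e j, z⟫_ℝ ^ 2) • (⟪e i, v⟫_ℝ • e i)) := by
    intro i j
    simp only [planeRotation_apply, inner_sub_left, real_inner_smul_left]
    module
  simp only [h, Finset.sum_sub_distrib, ← Finset.smul_sum, ← Finset.sum_smul]
  module

theorem sum_planeRotation_planeRotation (e : ι → E) (he : Orthonormal ℝ e) (z : E) :
    ∑ i, ∑ j, planeRotation (e i) (e j) (planeRotation (e i) (e j) z) =
      (2 - 2 * (Fintype.card ι : ℝ)) • ∑ i, ⟪e i, z⟫_ℝ • e i := by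
  classical
  have h : ∀ i j, planeRotation (e i) (e j) (planeRotation (e i) (e j) z) =
      (if i = j then (2 : ℝ) • ⟪e i, z⟫_ℝ • e i else 0) - ⟪e j, z⟫_ℝ • e j - ⟪e i, z⟫_ℝ • e i := by
    intro i j
    have h1 := (orthonormal_iff_ite.1 he)
    simp only [planeRotation_apply, inner_sub_right, real_inner_smul_right, h1]
    by_cases hij : i = j
    · subst hij; simp; module
    · simp [hij, Ne.symm hij]
  simp only [h, Finset.sum_sub_distrib, Finset.sum_ite_eq, Finset.mem_univ, if_true,
    Finset.sum_const, Finset.card_univ, ← Finset.smul_sum, ← Nat.cast_smul_eq_nsmul ℝ]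
  module

end Sum

variable [CompleteSpace E]

theorem mem_skewAdjoint_iff_inner {A : E →L[ℝ] E} :
    A ∈ skewAdjoint (E →L[ℝ] E) ↔ ∀ v w, ⟪A v, w⟫_ℝ = -⟪v, A w⟫_ℝ := by
  rw [skewAdjoint.mem_iff, ContinuousLinearMap.star_eq_adjoint, eq_comm,
    ContinuousLinearMap.eq_adjoint_iff]
  constructor
  · intro h v w
    have := h v w
    simp only [neg_apply, inner_neg_left] at this
    linarith
  · intro h v w
    simp only [neg_apply, inner_neg_left]
    linarith [h v w]

theorem planeRotation_mem_skewAdjoint (a b : E) :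
    planeRotation a b ∈ skewAdjoint (E →L[ℝ] E) := by
  rw [mem_skewAdjoint_iff_inner]
  intro v w
  simp only [planeRotation_apply, inner_sub_left, inner_sub_right, real_inner_smul_left,
    real_inner_smul_right, real_inner_comm v]
  ring

theorem inner_apply_self_of_skewAdjoint {A : E →L[ℝ] E} (hA : A ∈ skewAdjoint (E →L[ℝ] E)) (v : E) :
    ⟪A v, v⟫_ℝ = 0 := by
  have := mem_skewAdjoint_iff_inner.1 hA v v
  rw [real_inner_comm v (A v)] at this
  linarith [real_inner_comm v (A v)]

end PlaneRotation

section Flow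

variable {E : Type*} [NormedAddCommGroup E] [InnerProductSpace ℝ E]

theorem exp_zero_smul_apply (A : E →L[ℝ] E) (z : E) : NormedSpace.exp ((0 : ℝ) • A) z = z := by
  simp

theorem apply_exp_smul_of_commute {P A : E →L[ℝ] E} (h : Commute P A) (s : ℝ) (z : E) :
    P (NormedSpace.exp (s • A) z) = NormedSpace.exp (s • A) (P z) := by
  have h' : Commute P (s • A) := h.smul_right s
  let _ : NormedAlgebra ℚ (E →L[ℝ] E) := NormedAlgebra.restrictScalars ℚ ℝ _
  have h : Commute P (NormedSpace.exp (s • A)) := h'.exp_right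
  exact congrArg (fun T : E →L[ℝ] E => T z) h.eq

variable [CompleteSpace E]

theorem hasDerivAt_exp_smul_apply (A : E →L[ℝ] E) (z : E) (s : ℝ) :
    HasDerivAt (fun s : ℝ => NormedSpace.exp (s • A) z) (A (NormedSpace.exp (s • A) z)) s := by
  have h := hasDerivAt_exp_smul_const' (𝕂 := ℝ) A s
  simpa using h.clm_apply (hasDerivAt_const s z)

theorem exp_smul_mem_unitary {A : E →L[ℝ] E} (hA : A ∈ skewAdjoint (E →L[ℝ] E)) (s : ℝ) :
    NormedSpace.exp (s • A) ∈ unitary (E →L[ℝ] E) := by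
  let _ : NormedAlgebra ℚ (E →L[ℝ] E) := NormedAlgebra.restrictScalars ℚ ℝ _
  exact NormedSpace.exp_mem_unitary_of_mem_skewAdjoint (skewAdjoint.smul_mem s hA)

theorem exp_add_smul_apply (A : E →L[ℝ] E) (r s : ℝ) (z : E) :
    NormedSpace.exp ((r + s) • A) z = NormedSpace.exp (s • A) (NormedSpace.exp (r • A) z) := by
  let _ : NormedAlgebra ℚ (E →L[ℝ] E) := NormedAlgebra.restrictScalars ℚ ℝ _
  rw [add_comm, add_smul, NormedSpace.exp_add_of_commute]
  · rfl
  · exact ((Commute.refl A).smul_left s).smul_right r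

theorem hasDerivAt_exp_smul_apply_zero (A : E →L[ℝ] E) (z : E) :
    HasDerivAt (fun s : ℝ => NormedSpace.exp (s • A) z) (A z) 0 := by
  simpa using hasDerivAt_exp_smul_apply A z 0

end Flow

section Splitting

variable {p q : ℕ}

/-- The inclusion of the first factor. -/
def inclFst (p q : ℕ) : EuclideanSpace ℝ (Fin (p + 1)) →L[ℝ] Ambient p q :=
  (WithLp.prodContinuousLinearEquiv 2 ℝ (EuclideanSpace ℝ (Fin (p + 1)))
    (EuclideanSpace ℝ (Fin (q + 1)))).symm.toContinuousLinearMap ∘L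
    (ContinuousLinearMap.inl ℝ _ _)

/-- The inclusion of the second factor. -/
def inclSnd (p q : ℕ) : EuclideanSpace ℝ (Fin (q + 1)) →L[ℝ] Ambient p q :=
  (WithLp.prodContinuousLinearEquiv 2 ℝ (EuclideanSpace ℝ (Fin (p + 1)))
    (EuclideanSpace ℝ (Fin (q + 1)))).symm.toContinuousLinearMap ∘L
    (ContinuousLinearMap.inr ℝ _ _)

/-- The orthogonal projection of `ℝ^{p+1} × ℝ^{q+1}` to the first factor. -/
def projFst (p q : ℕ) : Ambient p q →L[ℝ] Ambient p q :=
  inclFst p q ∘L WithLp.fstL 2 ℝ _ _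

/-- The orthogonal projection of `ℝ^{p+1} × ℝ^{q+1}` to the second factor. -/
def projSnd (p q : ℕ) : Ambient p q →L[ℝ] Ambient p q :=
  inclSnd p q ∘L WithLp.sndL 2 ℝ _ _

theorem projFst_apply (z : Ambient p q) : projFst p q z = WithLp.toLp 2 (z.fst, 0) := rfl

theorem projSnd_apply (z : Ambient p q) : projSnd p q z = WithLp.toLp 2 (0, z.snd) := rfl

theorem ambient_ext {z w : Ambient p q} (h1 : z.fst = w.fst) (h2 : z.snd = w.snd) : z = w := by
  apply (WithLp.equiv 2 _).injective
  exact Prod.ext h1 h2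

theorem projFst_add_projSnd (z : Ambient p q) : projFst p q z + projSnd p q z = z := by
  apply ambient_ext <;> simp [projFst_apply, projSnd_apply]

theorem inner_ambient (z w : Ambient p q) :
    ⟪z, w⟫_ℝ = ⟪z.fst, w.fst⟫_ℝ + ⟪z.snd, w.snd⟫_ℝ := rfl

theorem inner_projFst_left (z w : Ambient p q) : ⟪projFst p q z, w⟫_ℝ = ⟪z.fst, w.fst⟫_ℝ := by
  simp [projFst_apply]

theorem inner_projSnd_left (z w : Ambient p q) : ⟪projSnd p q z, w⟫_ℝ = ⟪z.snd, w.snd⟫_ℝ := by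
  simp [projSnd_apply]

theorem norm_projFst (z : Ambient p q) : ‖projFst p q z‖ = ‖z.fst‖ := by
  rw [projFst_apply]; exact WithLp.norm_toLp_fst 2 _ _ _

theorem norm_projSnd (z : Ambient p q) : ‖projSnd p q z‖ = ‖z.snd‖ := by
  rw [projSnd_apply]; exact WithLp.norm_toLp_snd 2 _ _ _

/-- The coordinate vectors of the first factor. -/
def vecFst (p q : ℕ) (i : Fin (p + 1)) : Ambient p q :=
  WithLp.toLp 2 (EuclideanSpace.basisFun (Fin (p + 1)) ℝ i, 0)

/-- The coordinate vectors of the second factor. -/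
def vecSnd (p q : ℕ) (j : Fin (q + 1)) : Ambient p q :=
  WithLp.toLp 2 (0, EuclideanSpace.basisFun (Fin (q + 1)) ℝ j)

@[simp] theorem vecFst_fst (i : Fin (p + 1)) :
    (vecFst p q i).fst = EuclideanSpace.basisFun (Fin (p + 1)) ℝ i := rfl
@[simp] theorem vecFst_snd (i : Fin (p + 1)) : (vecFst p q i).snd = 0 := rfl
@[simp] theorem vecSnd_snd (i : Fin (q + 1)) :
    (vecSnd p q i).snd = EuclideanSpace.basisFun (Fin (q + 1)) ℝ i := rfl
@[simp] theorem vecSnd_fst (i : Fin (q + 1)) : (vecSnd p q i).fst = 0 := rfl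

theorem inner_vecFst (i : Fin (p + 1)) (z : Ambient p q) : ⟪vecFst p q i, z⟫_ℝ = z.fst i := by
  rw [inner_ambient, vecFst_fst, vecFst_snd, inner_zero_left, add_zero,
    ← OrthonormalBasis.repr_apply_apply, EuclideanSpace.basisFun_repr]

theorem inner_vecSnd (i : Fin (q + 1)) (z : Ambient p q) : ⟪vecSnd p q i, z⟫_ℝ = z.snd i := by
  rw [inner_ambient, vecSnd_fst, vecSnd_snd, inner_zero_left, zero_add,
    ← OrthonormalBasis.repr_apply_apply, EuclideanSpace.basisFun_repr]

theorem orthonormal_vecFst : Orthonormal ℝ (vecFst p q) := by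
  rw [orthonormal_iff_ite]
  intro i j
  simp only [inner_vecFst, vecFst_fst, EuclideanSpace.basisFun_apply, PiLp.single_apply]

theorem orthonormal_vecSnd : Orthonormal ℝ (vecSnd p q) := by
  rw [orthonormal_iff_ite]
  intro i j
  simp only [inner_vecSnd, vecSnd_snd, EuclideanSpace.basisFun_apply, PiLp.single_apply]

theorem sum_smul_vecFst (z : Ambient p q) :
    ∑ i, z.fst i • vecFst p q i = projFst p q z := by
  have h := congrArg (inclFst p q) ((EuclideanSpace.basisFun (Fin (p + 1)) ℝ).sum_repr z.fst)
  simp only [map_sum, map_smul, EuclideanSpace.basisFun_repr] at h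
  exact h

theorem sum_smul_vecSnd (z : Ambient p q) :
    ∑ i, z.snd i • vecSnd p q i = projSnd p q z := by
  have h := congrArg (inclSnd p q) ((EuclideanSpace.basisFun (Fin (q + 1)) ℝ).sum_repr z.snd)
  simp only [map_sum, map_smul, EuclideanSpace.basisFun_repr] at h
  exact h

end Splitting

section Generators

variable {p q : ℕ} {A : Ambient p q →L[ℝ] Ambient p q}

theorem PreservesSplitting.commute_projFst (hA : PreservesSplitting A) :
    Commute (projFst p q) A := by
  ext1 z
  have h1 := hA.1 (projFst p q z) rfl
  have h2 := hA.2 (projSnd p q z) rfl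
  change projFst p q (A z) = A (projFst p q z)
  conv_lhs => rw [← projFst_add_projSnd z, map_add, map_add]
  apply ambient_ext
  · simpa [projFst_apply (A (projFst p q z)), projFst_apply (A (projSnd p q z))] using h2
  · simpa [projFst_apply (A (projFst p q z)), projFst_apply (A (projSnd p q z))] using h1.symm

theorem projFst_exp (hA : PreservesSplitting A) (s : ℝ) (z : Ambient p q) :
    projFst p q (NormedSpace.exp (s • A) z) = NormedSpace.exp (s • A) (projFst p q z) := 
  apply_exp_smul_of_commute hA.commute_projFst s z

theorem projSnd_exp (hA : PreservesSplitting A) (s : ℝ) (z : Ambient p q) :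
    projSnd p q (NormedSpace.exp (s • A) z) = NormedSpace.exp (s • A) (projSnd p q z) := by
  have h1 := projFst_add_projSnd (NormedSpace.exp (s • A) z)
  have h2 := congrArg (NormedSpace.exp (s • A) : Ambient p q →L[ℝ] Ambient p q)
    (projFst_add_projSnd z)
  rw [map_add, ← projFst_exp hA] at h2
  exact (add_left_cancel (h2.trans h1.symm)).symm

theorem norm_fst_exp (hA : A ∈ skewAdjoint _) (hA' : PreservesSplitting A) (s : ℝ)
    (z : Ambient p q) : ‖(NormedSpace.exp (s • A) z).fst‖ = ‖z.fst‖ := by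
  rw [← norm_projFst, projFst_exp hA',
    ContinuousLinearMap.norm_map_of_mem_unitary (exp_smul_mem_unitary hA s), norm_projFst]

theorem norm_snd_exp (hA : A ∈ skewAdjoint _) (hA' : PreservesSplitting A) (s : ℝ)
    (z : Ambient p q) : ‖(NormedSpace.exp (s • A) z).snd‖ = ‖z.snd‖ := by
  rw [← norm_projSnd, projSnd_exp hA',
    ContinuousLinearMap.norm_map_of_mem_unitary (exp_smul_mem_unitary hA s), norm_projSnd]

theorem exp_mem_clifford {t : ℝ} (hA : A ∈ skewAdjoint _) (hA' : PreservesSplitting A) (s : ℝ)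
    {z : Ambient p q} (hz : z ∈ clifford p q t) : NormedSpace.exp (s • A) z ∈ clifford p q t :=
  ⟨(norm_fst_exp hA hA' s z).trans hz.1, (norm_snd_exp hA hA' s z).trans hz.2⟩

theorem preservesSplitting_planeRotation_of_snd {a b : Ambient p q} (ha : a.snd = 0)
    (hb : b.snd = 0) : PreservesSplitting (planeRotation a b) := by
  constructor <;> intro z hz <;> simp [ha, hb, hz]

theorem preservesSplitting_planeRotation_of_fst {a b : Ambient p q} (ha : a.fst = 0)
    (hb : b.fst = 0) : PreservesSplitting (planeRotation a b) := by
  constructor <;> intro z hz <;> simp [ha, hb, hz]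

/-- Indices of the coordinate planes of the two factors. -/
abbrev PlaneIndex (p q : ℕ) : Type :=
  (Fin (p + 1) × Fin (p + 1)) ⊕ (Fin (q + 1) × Fin (q + 1))

/-- The infinitesimal rotations in the coordinate planes of the two factors. -/
def generator (p q : ℕ) : PlaneIndex p q → Ambient p q →L[ℝ] Ambient p q
  | .inl i => planeRotation (vecFst p q i.1) (vecFst p q i.2)
  | .inr i => planeRotation (vecSnd p q i.1) (vecSnd p q i.2)

/-- The weights with which the squares of the infinitesimal rotations sum to the Laplacian. Every
plane is counted twice. -/
def weight (p q : ℕ) (t : ℝ) : PlaneIndex p q → ℝ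
  | .inl _ => 1 / (2 * Real.cos t ^ 2)
  | .inr _ => 1 / (2 * Real.sin t ^ 2)

theorem generator_mem_skewAdjoint (I : PlaneIndex p q) :
    generator p q I ∈ skewAdjoint (Ambient p q →L[ℝ] Ambient p q) := by
  cases I <;> exact planeRotation_mem_skewAdjoint _ _

theorem preservesSplitting_generator (I : PlaneIndex p q) :
    PreservesSplitting (generator p q I) := by
  cases I
  · exact preservesSplitting_planeRotation_of_snd rfl rfl
  · exact preservesSplitting_planeRotation_of_fst rfl rfl

theorem sum_weight_generator {F : Type*} [AddCommGroup F] [Module ℝ F] (t : ℝ)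
    (f : (Ambient p q →L[ℝ] Ambient p q) → F) :
    ∑ I, weight p q t I • f (generator p q I) =
      (1 / (2 * Real.cos t ^ 2)) •
        ∑ i, ∑ j, f (planeRotation (vecFst p q i) (vecFst p q j)) +
      (1 / (2 * Real.sin t ^ 2)) •
        ∑ i, ∑ j, f (planeRotation (vecSnd p q i) (vecSnd p q j)) := by
  simp only [Fintype.sum_sum_type, Fintype.sum_prod_type, weight, generator, Finset.smul_sum]

theorem sum_weight_inner_generator_smul {t : ℝ} (hc : Real.cos t ≠ 0) (hs : Real.sin t ≠ 0)
    {z : Ambient p q} (hz : z ∈ clifford p q t) (v : Ambient p q) :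
    ∑ I, weight p q t I • ⟪generator p q I z, v⟫_ℝ • generator p q I z =
      v - (⟪z.fst, v.fst⟫_ℝ / Real.cos t ^ 2) • projFst p q z -
        (⟪z.snd, v.snd⟫_ℝ / Real.sin t ^ 2) • projSnd p q z := by
  rw [sum_weight_generator t (fun A => ⟪A z, v⟫_ℝ • A z), sum_inner_planeRotation_smul,
    sum_inner_planeRotation_smul]
  simp only [inner_vecFst, inner_vecSnd, sum_smul_vecFst, sum_smul_vecSnd]
  have h1 : ∑ i, z.fst i ^ 2 = Real.cos t ^ 2 := by
    rw [← hz.1, EuclideanSpace.real_norm_sq_eq]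
  have h2 : ∑ i, z.snd i ^ 2 = Real.sin t ^ 2 := by
    rw [← hz.2, EuclideanSpace.real_norm_sq_eq]
  have h3 : ∑ i, z.fst i * v.fst i = ⟪z.fst, v.fst⟫_ℝ := by
    simp [PiLp.inner_apply, mul_comm]
  have h4 : ∑ i, z.snd i * v.snd i = ⟪z.snd, v.snd⟫_ℝ := by
    simp [PiLp.inner_apply, mul_comm]
  rw [h1, h2, h3, h4]
  conv_rhs => lhs; lhs; rw [← projFst_add_projSnd v]
  match_scalars <;> field_simp

theorem sum_weight_generator_generator {t : ℝ} (z : Ambient p q) :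
    ∑ I, weight p q t I • generator p q I (generator p q I z) =
      -((p / Real.cos t ^ 2) • projFst p q z + (q / Real.sin t ^ 2) • projSnd p q z) := by
  rw [sum_weight_generator t (fun A => A (A z)),
    sum_planeRotation_planeRotation _ orthonormal_vecFst,
    sum_planeRotation_planeRotation _ orthonormal_vecSnd]
  simp only [inner_vecFst, inner_vecSnd, sum_smul_vecFst, sum_smul_vecSnd, Fintype.card_fin]
  match_scalars <;> simp <;> ring

end Generators

section TangentSpace

variable {E : Type*} [NormedAddCommGroup E] [InnerProductSpace ℝ E]

theorem HasFDerivWithinAt.apply_eq_of_mem_tangentSpaceAt {F : Type*} [NormedAddCommGroup F]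
    [NormedSpace ℝ F] {M : Set E} {z : E} {f : E → F} {f₁ f₂ : E →L[ℝ] F}
    (h₁ : HasFDerivWithinAt f f₁ M z) (h₂ : HasFDerivWithinAt f f₂ M z) {v : E}
    (hv : v ∈ tangentSpaceAt M z) : f₁ v = f₂ v := by
  suffices h : tangentSpaceAt M z ≤ LinearMap.eqLocus (f₁ : E →ₗ[ℝ] F) (f₂ : E →ₗ[ℝ] F) from h hv
  refine Submodule.span_le.2 ?_
  rintro w ⟨γ, h0, hγ, hw⟩
  have hm : ∀ᶠ s in nhds (0 : ℝ), γ s ∈ M := Filter.Eventually.of_forall hγ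
  subst h0
  exact (h₁.comp_hasDerivAt 0 hw hm).unique (h₂.comp_hasDerivAt 0 hw hm)

theorem fderivWithin_apply_of_mem_tangentSpaceAt {F : Type*} [NormedAddCommGroup F]
    [NormedSpace ℝ F] {M : Set E} {z : E} {f : E → F} {f' : E →L[ℝ] F}
    (h : HasFDerivWithinAt f f' M z) {v : E} (hv : v ∈ tangentSpaceAt M z) :
    fderivWithin ℝ f M z v = f' v :=
  HasFDerivWithinAt.apply_eq_of_mem_tangentSpaceAt h.differentiableWithinAt.hasFDerivWithinAt h hv

theorem inner_map_velocity_eq_zero {P : E →L[ℝ] E} {γ : ℝ → E} {w : E} {r : ℝ}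
    (hw : HasDerivAt γ w 0) (h : ∀ s, ‖P (γ s)‖ = r) : ⟪P (γ 0), P w⟫_ℝ = 0 := by
  have hw1 : HasDerivAt (fun s => P (γ s)) (P w) 0 := P.hasFDerivAt.comp_hasDerivAt 0 hw
  have d1 := hw1.norm_sq
  simp only [h] at d1
  have f1 := d1.unique (hasDerivAt_const _ _)
  linarith

theorem trace_orthogonalProjection_comp [FiniteDimensional ℝ E] (T : Submodule ℝ E)
    {ι : Type*} [Fintype ι] (w : ι → ℝ) (a : ι → E)
    (hT : ∀ v, T.starProjection v = ∑ i, w i • ⟪a i, v⟫_ℝ • a i) (D : E →L[ℝ] E) :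
    LinearMap.trace ℝ T ((T.orthogonalProjectionOnto ∘L D ∘L T.subtypeL : T →L[ℝ] T) :
      T →ₗ[ℝ] T) = ∑ i, w i * ⟪D (a i), a i⟫_ℝ := by
  have h1 : ((T.orthogonalProjectionOnto ∘L D ∘L T.subtypeL : T →L[ℝ] T) : T →ₗ[ℝ] T) =
      (T.orthogonalProjectionOnto : E →ₗ[ℝ] T) ∘ₗ ((D : E →ₗ[ℝ] E) ∘ₗ T.subtype) := rfl
  have h2 : ((D : E →ₗ[ℝ] E) ∘ₗ T.subtype) ∘ₗ (T.orthogonalProjectionOnto : E →ₗ[ℝ] T) =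
      ∑ i, w i • ((InnerProductSpace.rankOne ℝ (D (a i)) (a i) : E →L[ℝ] E) : E →ₗ[ℝ] E) := by
    ext v
    have h3 := congrArg D (hT v)
    simp only [map_sum, map_smul] at h3
    simpa using h3
  rw [h1, LinearMap.trace_comp_comm', h2, map_sum]
  refine Finset.sum_congr rfl fun i _ => ?_
  rw [map_smul, InnerProductSpace.trace_rankOne, smul_eq_mul, real_inner_comm]

end TangentSpace

section CliffordTangent

variable {p q : ℕ} {t : ℝ} {z : Ambient p q}

theorem generator_apply_mem_tangentSpaceAt (hz : z ∈ clifford p q t) (I : PlaneIndex p q) :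
    generator p q I z ∈ tangentSpaceAt (clifford p q t) z := by
  refine Submodule.subset_span ⟨fun s => NormedSpace.exp (s • generator p q I) z,
    exp_zero_smul_apply _ _,
    fun s => exp_mem_clifford (generator_mem_skewAdjoint I) (preservesSplitting_generator I) s hz,
    ?_⟩
  exact hasDerivAt_exp_smul_apply_zero (generator p q I) z

theorem mem_tangentSpaceAt_clifford (hc : Real.cos t ≠ 0) (hs : Real.sin t ≠ 0)
    (hz : z ∈ clifford p q t) {v : Ambient p q} :
    v ∈ tangentSpaceAt (clifford p q t) z ↔ ⟪z.fst, v.fst⟫_ℝ = 0 ∧ ⟪z.snd, v.snd⟫_ℝ = 0 := by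
  constructor
  · intro hv
    have h1 : tangentSpaceAt (clifford p q t) z ≤ (ℝ ∙ projFst p q z)ᗮ ⊓ (ℝ ∙ projSnd p q z)ᗮ := by
      refine Submodule.span_le.2 ?_
      rintro w ⟨γ, h0, hγ, hw⟩
      have f1 := inner_map_velocity_eq_zero (P := projFst p q) hw
        fun s => (norm_projFst _).trans (hγ s).1
      have f2 := inner_map_velocity_eq_zero (P := projSnd p q) hw
        fun s => (norm_projSnd _).trans (hγ s).2
      rw [h0, inner_projFst_left] at f1
      rw [h0, inner_projSnd_left] at f2
      constructor
      · exact Submodule.mem_orthogonal_singleton_iff_inner_right.2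
          ((inner_projFst_left z w).trans f1)
      · exact Submodule.mem_orthogonal_singleton_iff_inner_right.2
          ((inner_projSnd_left z w).trans f2)
    obtain ⟨h2, h3⟩ := Submodule.mem_inf.1 (h1 hv)
    rw [Submodule.mem_orthogonal_singleton_iff_inner_right] at h2 h3
    exact ⟨(inner_projFst_left z v).symm.trans h2, (inner_projSnd_left z v).symm.trans h3⟩
  · rintro ⟨h1, h2⟩
    have h := sum_weight_inner_generator_smul hc hs hz v
    rw [h1, h2] at h
    simp only [zero_div, zero_smul, sub_zero] at h
    rw [← h]
    exact Submodule.sum_mem _ fun I _ => Submodule.smul_mem _ _ (Submodule.smul_mem _ _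
      (generator_apply_mem_tangentSpaceAt hz I))

theorem starProjection_tangentSpaceAt_clifford (hc : Real.cos t ≠ 0) (hs : Real.sin t ≠ 0)
    (hz : z ∈ clifford p q t) (v : Ambient p q) :
    (tangentSpaceAt (clifford p q t) z).starProjection v =
      ∑ I, weight p q t I • ⟪generator p q I z, v⟫_ℝ • generator p q I z := by
  refine Submodule.eq_starProjection_of_mem_of_inner_eq_zero ?_ ?_
  · exact Submodule.sum_mem _ fun I _ => Submodule.smul_mem _ _ (Submodule.smul_mem _ _
      (generator_apply_mem_tangentSpaceAt hz I))
  · intro w hw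
    rw [mem_tangentSpaceAt_clifford hc hs hz] at hw
    rw [sum_weight_inner_generator_smul hc hs hz]
    simp only [inner_sub_left, real_inner_smul_left, inner_projFst_left, inner_projSnd_left,
      hw.1, hw.2]
    ring

theorem surfaceDivergence_clifford (hc : Real.cos t ≠ 0) (hs : Real.sin t ≠ 0)
    (hz : z ∈ clifford p q t) {X : Ambient p q → Ambient p q} {D : Ambient p q →L[ℝ] Ambient p q}
    (hX : HasFDerivWithinAt X D (clifford p q t) z) :
    surfaceDivergence (clifford p q t) X z =
      ∑ I, weight p q t I * ⟪D (generator p q I z), generator p q I z⟫_ℝ := by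
  rw [← trace_orthogonalProjection_comp _ _ _ (starProjection_tangentSpaceAt_clifford hc hs hz) D]
  unfold surfaceDivergence
  congr 2
  ext v
  simp only [ContinuousLinearMap.comp_apply, Submodule.subtypeL_apply]
  rw [fderivWithin_apply_of_mem_tangentSpaceAt hX v.2]

theorem cliffordNormal_eq (z : Ambient p q) : cliffordNormal p q t z =
    ((Real.sin t / Real.cos t) • projFst p q - (Real.cos t / Real.sin t) • projSnd p q) z := by
  apply ambient_ext <;> simp [cliffordNormal, projFst_apply, projSnd_apply]

theorem normSqSecondFundamentalForm_clifford (hc : Real.cos t ≠ 0) (hs : Real.sin t ≠ 0)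
    (hz : z ∈ clifford p q t) :
    normSqSecondFundamentalForm (clifford p q t) (cliffordNormal p q t) z =
      p * (Real.sin t / Real.cos t) ^ 2 + q * (Real.cos t / Real.sin t) ^ 2 := by
  set N : Ambient p q →L[ℝ] Ambient p q :=
    (Real.sin t / Real.cos t) • projFst p q - (Real.cos t / Real.sin t) • projSnd p q with hN
  have hNfst : ∀ v, (N v).fst = (Real.sin t / Real.cos t) • v.fst := by
    intro v; simp [hN, projFst_apply, projSnd_apply]
  have hNsnd : ∀ v, (N v).snd = -((Real.cos t / Real.sin t) • v.snd) := by
    intro v; simp [hN, projFst_apply, projSnd_apply]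
  have hNe : cliffordNormal p q t = N := funext cliffordNormal_eq
  have hsymm : ∀ v w, ⟪N v, w⟫_ℝ = ⟪v, N w⟫_ℝ := by
    intro v w
    simp only [inner_ambient, hNfst, hNsnd, real_inner_smul_left, real_inner_smul_right,
      inner_neg_left, inner_neg_right]
  have hcomm : ∀ I v, N (generator p q I v) = generator p q I (N v) := by
    intro I v
    have h1 := congrArg (fun T : Ambient p q →L[ℝ] Ambient p q => T v)
      (preservesSplitting_generator I).commute_projFst.eq
    have h1 : projFst p q (generator p q I v) = generator p q I (projFst p q v) := h1
    have h2 : projSnd p q (generator p q I v) = generator p q I (projSnd p q v) := by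
      have e1 := projFst_add_projSnd (generator p q I v)
      have e2 := congrArg (generator p q I) (projFst_add_projSnd v)
      rw [map_add, ← h1] at e2
      exact add_left_cancel (e1.trans e2.symm)
    simp [hN, h1, h2]
  set T := tangentSpaceAt (clifford p q t) z with hT
  have hmem : ∀ v ∈ T, N v ∈ T := by
    intro v hv
    rw [hT, mem_tangentSpaceAt_clifford hc hs hz] at hv ⊢
    simp [hNfst, hNsnd, real_inner_smul_right, hv.1, hv.2]
  have hder : HasFDerivWithinAt (cliffordNormal p q t) N (clifford p q t) z := by
    rw [hNe]; exact N.hasFDerivAt.hasFDerivWithinAt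
  set b := stdOrthonormalBasis ℝ T with hb
  have h1 : ∀ i, ∑ j, secondFundamentalForm (clifford p q t) (cliffordNormal p q t) z
      (b i : Ambient p q) (b j : Ambient p q) ^ 2 =
      ⟪b i, (T.orthogonalProjectionOnto ∘L (N ∘L N) ∘L T.subtypeL : T →L[ℝ] T) (b i)⟫_ℝ := by
    intro i
    have h2 : ∀ j, secondFundamentalForm (clifford p q t) (cliffordNormal p q t) z
      (b i : Ambient p q) (b j : Ambient p q) ^ 2 =
        ⟪(⟨N (b i), hmem _ (b i).2⟩ : T), b j⟫_ℝ ^ 2 := by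
      intro j
      unfold secondFundamentalForm
      rw [fderivWithin_apply_of_mem_tangentSpaceAt hder (b i).2, neg_sq]
      rfl
    rw [Finset.sum_congr rfl fun j _ => h2 j, OrthonormalBasis.sum_sq_inner_left]
    rw [← real_inner_self_eq_norm_sq]
    change ⟪N (b i), N (b i)⟫_ℝ = _
    rw [hsymm, ← Submodule.inner_orthogonalProjectionOnto_eq_of_mem_left]
    rfl
  unfold normSqSecondFundamentalForm
  rw [Finset.sum_congr rfl fun i _ => h1 i]
  have h3 := LinearMap.trace_eq_sum_inner
    ((T.orthogonalProjectionOnto ∘L (N ∘L N) ∘L T.subtypeL : T →L[ℝ] T) : T →ₗ[ℝ] T) b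
  refine h3.symm.trans ?_
  rw [trace_orthogonalProjection_comp _ _ _ (starProjection_tangentSpaceAt_clifford hc hs hz)]
  have h4 : ∀ I, weight p q t I * ⟪(N ∘L N) (generator p q I z), generator p q I z⟫_ℝ =
      -⟪weight p q t I • generator p q I (generator p q I (N z)), N z⟫_ℝ := by
    intro I
    rw [ContinuousLinearMap.comp_apply, hsymm, hcomm, real_inner_smul_left,
      mem_skewAdjoint_iff_inner.1 (generator_mem_skewAdjoint I) (generator p q I (N z))]
    ring
  rw [Finset.sum_congr rfl fun I _ => h4 I, Finset.sum_neg_distrib, ← sum_inner,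
    sum_weight_generator_generator, inner_neg_left, neg_neg, inner_add_left, real_inner_smul_left,
    real_inner_smul_left, inner_projFst_left, inner_projSnd_left, hNfst, hNsnd]
  simp only [real_inner_smul_left, real_inner_smul_right, inner_neg_left, inner_neg_right,
    real_inner_self_eq_norm_sq z.fst, real_inner_self_eq_norm_sq z.snd, hz.1, hz.2]
  field_simp

end CliffordTangent

section Retraction

variable {p q : ℕ} {t : ℝ}

/-- The points both of whose components are nonzero. -/
def offAxes (p q : ℕ) : Set (Ambient p q) := {z | projFst p q z ≠ 0 ∧ projSnd p q z ≠ 0}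

/-- The radial retraction to `C_t` in both factors. -/
def retraction (p q : ℕ) (t : ℝ) (z : Ambient p q) : Ambient p q :=
  (Real.cos t / ‖projFst p q z‖) • projFst p q z + (Real.sin t / ‖projSnd p q z‖) • projSnd p q z

theorem isOpen_offAxes : IsOpen (offAxes p q) :=
  (isOpen_ne_fun (projFst p q).continuous continuous_const).inter
    (isOpen_ne_fun (projSnd p q).continuous continuous_const)

theorem clifford_subset_offAxes (hc : Real.cos t ≠ 0) (hs : Real.sin t ≠ 0) :
    clifford p q t ⊆ offAxes p q := by
  intro z hz
  constructor
  · rw [← norm_ne_zero_iff, norm_projFst, hz.1]; exact hc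
  · rw [← norm_ne_zero_iff, norm_projSnd, hz.2]; exact hs

theorem projFst_projFst (z : Ambient p q) : projFst p q (projFst p q z) = projFst p q z := rfl

theorem projSnd_projSnd (z : Ambient p q) : projSnd p q (projSnd p q z) = projSnd p q z := rfl

theorem projFst_projSnd (z : Ambient p q) : projFst p q (projSnd p q z) = 0 := by
  apply ambient_ext <;> simp [projFst_apply, projSnd_apply]

theorem projSnd_projFst (z : Ambient p q) : projSnd p q (projFst p q z) = 0 := by
  apply ambient_ext <;> simp [projFst_apply, projSnd_apply]

theorem mem_clifford_iff {z : Ambient p q} :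
    z ∈ clifford p q t ↔ ‖projFst p q z‖ = Real.cos t ∧ ‖projSnd p q z‖ = Real.sin t := by
  rw [norm_projFst, norm_projSnd]; rfl

theorem retraction_mem (hc : 0 < Real.cos t) (hs : 0 < Real.sin t) {z : Ambient p q}
    (hz : z ∈ offAxes p q) : retraction p q t z ∈ clifford p q t := by
  have h1 := norm_pos_iff.2 hz.1
  have h2 := norm_pos_iff.2 hz.2
  rw [mem_clifford_iff, retraction]
  simp only [map_add, map_smul, projFst_projFst, projSnd_projSnd, projFst_projSnd,
    projSnd_projFst, smul_zero, add_zero, zero_add, norm_smul, norm_div, Real.norm_eq_abs,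
    abs_of_pos hc, abs_of_pos hs, abs_of_pos h1, abs_of_pos h2]
  exact ⟨div_mul_cancel₀ _ h1.ne', div_mul_cancel₀ _ h2.ne'⟩

theorem retraction_of_mem (hc : Real.cos t ≠ 0) (hs : Real.sin t ≠ 0) {z : Ambient p q}
    (hz : z ∈ clifford p q t) : retraction p q t z = z := by
  rw [mem_clifford_iff] at hz
  rw [retraction, hz.1, hz.2, div_self hc, div_self hs, one_smul, one_smul, projFst_add_projSnd]

theorem retraction_smul_add_smul {a b : ℝ} (ha : 0 < a) (hb : 0 < b) (z : Ambient p q) :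
    retraction p q t (a • projFst p q z + b • projSnd p q z) = retraction p q t z := by
  simp only [retraction, map_add, map_smul, projFst_projFst, projSnd_projSnd, projFst_projSnd,
    projSnd_projFst, smul_zero, add_zero, zero_add, norm_smul, Real.norm_eq_abs,
    abs_of_pos ha, abs_of_pos hb, smul_smul]
  congr 2 <;> field_simp

theorem contDiffOn_retraction : ContDiffOn ℝ 2 (retraction p q t) (offAxes p q) := by
  have h1 : ContDiffOn ℝ 2 (fun z => ‖projFst p q z‖) (offAxes p q) :=
    (projFst p q).contDiff.contDiffOn.norm ℝ fun z hz => hz.1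
  have h2 : ContDiffOn ℝ 2 (fun z => ‖projSnd p q z‖) (offAxes p q) :=
    (projSnd p q).contDiff.contDiffOn.norm ℝ fun z hz => hz.2
  exact ((contDiffOn_const.div h1 fun z hz => norm_ne_zero_iff.2 hz.1).smul
    (projFst p q).contDiff.contDiffOn).add
    ((contDiffOn_const.div h2 fun z hz => norm_ne_zero_iff.2 hz.2).smul
    (projSnd p q).contDiff.contDiffOn)

end Retraction

/-- The Riesz representation of functionals on a real inner product space, as a linear map. -/
def rieszVector (E : Type*) [NormedAddCommGroup E] [InnerProductSpace ℝ E] [CompleteSpace E] :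
    StrongDual ℝ E →L[ℝ] E where
  toFun := (InnerProductSpace.toDual ℝ E).symm
  map_add' := map_add _
  map_smul' r y := by simp
  cont := (InnerProductSpace.toDual ℝ E).symm.continuous

section Extension

variable {p q : ℕ} {t : ℝ} {u : Ambient p q → ℝ}

/-- The extension of a function on `C_t` that is constant along the rays of both factors. -/
def radialExtension (p q : ℕ) (t : ℝ) (u : Ambient p q → ℝ) : Ambient p q → ℝ :=
  u ∘ retraction p q t

theorem contDiffOn_radialExtension (hc : 0 < Real.cos t) (hs : 0 < Real.sin t)
    (hu : ContDiffOn ℝ 2 u (clifford p q t)) :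
    ContDiffOn ℝ 2 (radialExtension p q t u) (offAxes p q) :=
  hu.comp contDiffOn_retraction fun _ hz => retraction_mem hc hs hz

theorem radialExtension_of_mem (hc : Real.cos t ≠ 0) (hs : Real.sin t ≠ 0) {z : Ambient p q}
    (hz : z ∈ clifford p q t) : radialExtension p q t u z = u z := by
  rw [radialExtension, Function.comp_apply, retraction_of_mem hc hs hz]

theorem hasFDerivAt_radialExtension (hc : 0 < Real.cos t) (hs : 0 < Real.sin t)
    (hu : ContDiffOn ℝ 2 u (clifford p q t)) {z : Ambient p q} (hz : z ∈ clifford p q t) :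
    HasFDerivAt (radialExtension p q t u) (fderiv ℝ (radialExtension p q t u) z) z :=
  (((contDiffOn_radialExtension hc hs hu).differentiableOn two_ne_zero).differentiableAt
    (isOpen_offAxes.mem_nhds (clifford_subset_offAxes hc.ne' hs.ne' hz))).hasFDerivAt

theorem hasFDerivAt_fderiv_radialExtension (hc : 0 < Real.cos t) (hs : 0 < Real.sin t)
    (hu : ContDiffOn ℝ 2 u (clifford p q t)) {z : Ambient p q} (hz : z ∈ clifford p q t) :
    HasFDerivAt (fderiv ℝ (radialExtension p q t u))
      (fderiv ℝ (fderiv ℝ (radialExtension p q t u)) z) z :=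
  ((((contDiffOn_radialExtension hc hs hu).fderiv_of_isOpen isOpen_offAxes
    (m := 1) (by norm_num [one_add_one_eq_two])).differentiableOn one_ne_zero).differentiableAt
    (isOpen_offAxes.mem_nhds (clifford_subset_offAxes hc.ne' hs.ne' hz))).hasFDerivAt

theorem hasFDerivWithinAt_of_radialExtension (hc : 0 < Real.cos t) (hs : 0 < Real.sin t)
    (hu : ContDiffOn ℝ 2 u (clifford p q t)) {z : Ambient p q} (hz : z ∈ clifford p q t) :
    HasFDerivWithinAt u (fderiv ℝ (radialExtension p q t u) z) (clifford p q t) z :=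
  (hasFDerivAt_radialExtension hc hs hu hz).hasFDerivWithinAt.congr
    (fun _ hw => (radialExtension_of_mem hc.ne' hs.ne' hw).symm)
    (radialExtension_of_mem hc.ne' hs.ne' hz).symm

theorem HasFDerivAt.apply_eq_zero_of_const_along {E : Type*} [NormedAddCommGroup E]
    [NormedSpace ℝ E] {U : E → ℝ} {U' : E →L[ℝ] ℝ} {z v : E} (h : HasFDerivAt U U' z)
    (hc : ∀ s : ℝ, -1 < s → U (z + s • v) = U z) : U' v = 0 := by
  have h1 := h.hasLineDerivAt v
  unfold HasLineDerivAt at h1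
  refine h1.unique ((hasDerivAt_const (0 : ℝ) (U z)).congr_of_eventuallyEq ?_)
  filter_upwards [lt_mem_nhds (show (-1 : ℝ) < 0 by norm_num)] with s hs using hc s hs

theorem fderiv_radialExtension_projFst (hc : 0 < Real.cos t) (hs : 0 < Real.sin t)
    (hu : ContDiffOn ℝ 2 u (clifford p q t)) {z : Ambient p q} (hz : z ∈ clifford p q t) :
    fderiv ℝ (radialExtension p q t u) z (projFst p q z) = 0 := by
  refine HasFDerivAt.apply_eq_zero_of_const_along (hasFDerivAt_radialExtension hc hs hu hz)
    fun s hs' => ?_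
  have h : z + s • projFst p q z = (1 + s) • projFst p q z + (1 : ℝ) • projSnd p q z := by
    conv_lhs => lhs; rw [← projFst_add_projSnd z]
    module
  rw [h, radialExtension, Function.comp_apply, Function.comp_apply,
    retraction_smul_add_smul (by linarith) one_pos]

theorem fderiv_radialExtension_projSnd (hc : 0 < Real.cos t) (hs : 0 < Real.sin t)
    (hu : ContDiffOn ℝ 2 u (clifford p q t)) {z : Ambient p q} (hz : z ∈ clifford p q t) :
    fderiv ℝ (radialExtension p q t u) z (projSnd p q z) = 0 := by
  refine HasFDerivAt.apply_eq_zero_of_const_along (hasFDerivAt_radialExtension hc hs hu hz)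
    fun s hs' => ?_
  have h : z + s • projSnd p q z = (1 : ℝ) • projFst p q z + (1 + s) • projSnd p q z := by
    conv_lhs => lhs; rw [← projFst_add_projSnd z]
    module
  rw [h, radialExtension, Function.comp_apply, Function.comp_apply,
    retraction_smul_add_smul one_pos (by linarith)]

theorem surfaceGradient_clifford (hc : 0 < Real.cos t) (hs : 0 < Real.sin t)
    (hu : ContDiffOn ℝ 2 u (clifford p q t)) {z : Ambient p q} (hz : z ∈ clifford p q t) :
    surfaceGradient (clifford p q t) u z =
      (InnerProductSpace.toDual ℝ (Ambient p q)).symm (fderiv ℝ (radialExtension p q t u) z) := by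
  refine Submodule.eq_starProjection_of_mem_of_inner_eq_zero ?_ fun v hv => ?_
  · rw [mem_tangentSpaceAt_clifford hc.ne' hs.ne' hz, ← inner_projFst_left, ← inner_projSnd_left,
      real_inner_comm, InnerProductSpace.toDual_symm_apply, real_inner_comm,
      InnerProductSpace.toDual_symm_apply]
    exact ⟨fderiv_radialExtension_projFst hc hs hu hz, fderiv_radialExtension_projSnd hc hs hu hz⟩
  · rw [gradientWithin, inner_sub_left, InnerProductSpace.toDual_symm_apply,
      InnerProductSpace.toDual_symm_apply, fderivWithin_apply_of_mem_tangentSpaceAt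
        (hasFDerivWithinAt_of_radialExtension hc hs hu hz) hv, sub_self]

theorem laplaceBeltrami_clifford_eq_sum_hessian (hc : 0 < Real.cos t) (hs : 0 < Real.sin t)
    (hu : ContDiffOn ℝ 2 u (clifford p q t)) {z : Ambient p q} (hz : z ∈ clifford p q t) :
    laplaceBeltrami (clifford p q t) u z = ∑ I, weight p q t I *
      fderiv ℝ (fderiv ℝ (radialExtension p q t u)) z (generator p q I z) (generator p q I z) := by
  have h : HasFDerivWithinAt (surfaceGradient (clifford p q t) u)
      (rieszVector (Ambient p q) ∘L
        fderiv ℝ (fderiv ℝ (radialExtension p q t u)) z) (clifford p q t) z := by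
    refine HasFDerivWithinAt.congr ?_ (fun w hw => surfaceGradient_clifford hc hs hu hw)
      (surfaceGradient_clifford hc hs hu hz)
    exact (rieszVector (Ambient p q)).hasFDerivAt.comp_hasFDerivWithinAt z
      (hasFDerivAt_fderiv_radialExtension hc hs hu hz).hasFDerivWithinAt
  rw [laplaceBeltrami, surfaceDivergence_clifford hc.ne' hs.ne' hz h]
  refine Finset.sum_congr rfl fun I _ => ?_
  congr 1
  exact InnerProductSpace.toDual_symm_apply

/-- The derivative of `u` along the flow of `A`. -/
def flowDeriv (p q : ℕ) (t : ℝ) (u : Ambient p q → ℝ) (A : Ambient p q →L[ℝ] Ambient p q)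
    (z : Ambient p q) : ℝ :=
  fderiv ℝ (radialExtension p q t u) z (A z)

/-- The second derivative of `u` along the flow of `A`. -/
def flowDerivTwo (p q : ℕ) (t : ℝ) (u : Ambient p q → ℝ) (A : Ambient p q →L[ℝ] Ambient p q)
    (z : Ambient p q) : ℝ :=
  fderiv ℝ (fderiv ℝ (radialExtension p q t u)) z (A z) (A z) +
    fderiv ℝ (radialExtension p q t u) z (A (A z))

theorem laplaceBeltrami_clifford (hc : 0 < Real.cos t) (hs : 0 < Real.sin t)
    (hu : ContDiffOn ℝ 2 u (clifford p q t)) {z : Ambient p q} (hz : z ∈ clifford p q t) :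
    laplaceBeltrami (clifford p q t) u z =
      ∑ I, weight p q t I * flowDerivTwo p q t u (generator p q I) z := by
  have h := congrArg (fderiv ℝ (radialExtension p q t u) z)
    (sum_weight_generator_generator (t := t) z)
  simp only [map_sum, map_smul, map_neg, map_add, smul_eq_mul,
    fderiv_radialExtension_projFst hc hs hu hz, fderiv_radialExtension_projSnd hc hs hu hz,
    mul_zero, add_zero, neg_zero] at h
  simp only [flowDerivTwo, mul_add, Finset.sum_add_distrib, h, add_zero,
    laplaceBeltrami_clifford_eq_sum_hessian hc hs hu hz]

theorem continuousOn_flowDeriv (hc : 0 < Real.cos t) (hs : 0 < Real.sin t)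
    (hu : ContDiffOn ℝ 2 u (clifford p q t)) (A : Ambient p q →L[ℝ] Ambient p q) :
    ContinuousOn (flowDeriv p q t u A) (clifford p q t) := by
  have h := (contDiffOn_radialExtension hc hs hu).fderiv_of_isOpen isOpen_offAxes
    (m := 1) (by norm_num [one_add_one_eq_two])
  exact (h.continuousOn.mono (clifford_subset_offAxes hc.ne' hs.ne')).clm_apply
    A.continuous.continuousOn

theorem continuousOn_flowDerivTwo (hc : 0 < Real.cos t) (hs : 0 < Real.sin t)
    (hu : ContDiffOn ℝ 2 u (clifford p q t)) (A : Ambient p q →L[ℝ] Ambient p q) :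
    ContinuousOn (flowDerivTwo p q t u A) (clifford p q t) := by
  have h := (contDiffOn_radialExtension hc hs hu).fderiv_of_isOpen isOpen_offAxes
    (m := 1) (by norm_num [one_add_one_eq_two])
  have h2 := h.fderiv_of_isOpen isOpen_offAxes (m := 0) (by norm_num)
  have hm := clifford_subset_offAxes (p := p) (q := q) hc.ne' hs.ne'
  exact (((h2.continuousOn.mono hm).clm_apply A.continuous.continuousOn).clm_apply
    A.continuous.continuousOn).add ((h.continuousOn.mono hm).clm_apply
      (A.continuous.comp A.continuous).continuousOn)

theorem hasDerivAt_exp_flowDeriv (hc : 0 < Real.cos t) (hs : 0 < Real.sin t)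
    (hu : ContDiffOn ℝ 2 u (clifford p q t)) {A : Ambient p q →L[ℝ] Ambient p q}
    (hA : A ∈ skewAdjoint _) (hA' : PreservesSplitting A) {z : Ambient p q}
    (hz : z ∈ clifford p q t) :
    HasDerivAt (fun s : ℝ => u (NormedSpace.exp (s • A) z)) (flowDeriv p q t u A z) 0 := by
  refine (hasFDerivWithinAt_of_radialExtension hc hs hu hz).comp_hasDerivAt_of_eq 0
    (hasDerivAt_exp_smul_apply_zero A z)
    (Filter.Eventually.of_forall fun s => exp_mem_clifford hA hA' s hz) ?_
  exact (exp_zero_smul_apply A z).symm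

theorem hasDerivAt_exp_flowDerivTwo (hc : 0 < Real.cos t) (hs : 0 < Real.sin t)
    (hu : ContDiffOn ℝ 2 u (clifford p q t)) (A : Ambient p q →L[ℝ] Ambient p q)
    {z : Ambient p q} (hz : z ∈ clifford p q t) :
    HasDerivAt (fun s : ℝ => flowDeriv p q t u A (NormedSpace.exp (s • A) z))
      (flowDerivTwo p q t u A z) 0 := by
  have h1 := (hasFDerivAt_fderiv_radialExtension hc hs hu hz).clm_apply A.hasFDerivAt
  have h2 := h1.comp_hasDerivAt_of_eq 0 (hasDerivAt_exp_smul_apply_zero A z)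
    (exp_zero_smul_apply A z).symm
  refine h2.congr_deriv ?_
  simp [flowDerivTwo, add_comm]

end Extension

section InvariantMeasure

open MeasureTheory

variable {p q : ℕ} {t : ℝ}

instance compactSpace_clifford : CompactSpace (clifford p q t) := by
  rw [← isCompact_iff_compactSpace]
  have hcl : IsClosed (clifford p q t) := by
    have h : clifford p q t =
        {z | ‖projFst p q z‖ = Real.cos t} ∩ {z | ‖projSnd p q z‖ = Real.sin t} := by
      ext z; exact mem_clifford_iff
    rw [h]
    exact (isClosed_eq (projFst p q).continuous.norm continuous_const).inter
      (isClosed_eq (projSnd p q).continuous.norm continuous_const)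
  refine Metric.isCompact_of_isClosed_isBounded hcl
    ((Metric.isBounded_closedBall (x := 0) (r := Real.cos t + Real.sin t)).subset ?_)
  intro z hz
  rw [mem_clifford_iff] at hz
  rw [mem_closedBall_zero_iff, ← hz.1, ← hz.2]
  conv_lhs => rw [← projFst_add_projSnd z]
  exact norm_add_le _ _

theorem smul_vecFst_add_smul_vecSnd_mem_clifford (hc : 0 < Real.cos t) (hs : 0 < Real.sin t)
    (k : Fin (p + 1)) (l : Fin (q + 1)) :
    Real.cos t • vecFst p q k + Real.sin t • vecSnd p q l ∈ clifford p q t := by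
  constructor
  · simp [norm_smul, abs_of_pos hc]
  · simp [norm_smul, abs_of_pos hs]

open scoped Classical in
/-- The radial retraction as a map to `C_t`, with an arbitrary value on the axes. -/
def retractionOnto (p q : ℕ) (t : ℝ) (hc : 0 < Real.cos t) (hs : 0 < Real.sin t)
    (z : Ambient p q) : clifford p q t :=
  ⟨if z ∈ offAxes p q then retraction p q t z else
      Real.cos t • vecFst p q 0 + Real.sin t • vecSnd p q 0, by
    split_ifs with h
    · exact retraction_mem hc hs h
    · exact smul_vecFst_add_smul_vecSnd_mem_clifford hc hs 0 0⟩

theorem coe_retractionOnto (hc : 0 < Real.cos t) (hs : 0 < Real.sin t) {z : Ambient p q}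
    (hz : z ∈ offAxes p q) : (retractionOnto p q t hc hs z : Ambient p q) = retraction p q t z :=
  if_pos hz

theorem measurable_retractionOnto (hc : 0 < Real.cos t) (hs : 0 < Real.sin t) :
    Measurable (retractionOnto p q t hc hs) := by
  refine Measurable.subtype_mk (Measurable.ite isOpen_offAxes.measurableSet ?_ measurable_const)
  have h1 : Measurable (projFst p q) := (projFst p q).continuous.measurable
  have h2 : Measurable (projSnd p q) := (projSnd p q).continuous.measurable
  exact ((measurable_const.div h1.norm).smul h1).add ((measurable_const.div h2.norm).smul h2)

theorem ae_mem_offAxes : ∀ᵐ z ∂(volume : Measure (Ambient p q)), z ∈ offAxes p q := by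
  have h1 : volume ((LinearMap.ker (projFst p q : Ambient p q →ₗ[ℝ] Ambient p q) :
      Submodule ℝ (Ambient p q)) : Set (Ambient p q)) = 0 := by
    refine Measure.addHaar_submodule _ _ fun h => ?_
    have h2 : projFst p q (vecFst p q 0) = 0 := by
      have : vecFst p q 0 ∈ LinearMap.ker (projFst p q : Ambient p q →ₗ[ℝ] Ambient p q) := by
        rw [h]; trivial
      exact this
    have h3 := norm_projFst (vecFst p q 0)
    rw [h2] at h3
    simp at h3
  have h2 : volume ((LinearMap.ker (projSnd p q : Ambient p q →ₗ[ℝ] Ambient p q) :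
      Submodule ℝ (Ambient p q)) : Set (Ambient p q)) = 0 := by
    refine Measure.addHaar_submodule _ _ fun h => ?_
    have h2 : projSnd p q (vecSnd p q 0) = 0 := by
      have : vecSnd p q 0 ∈ LinearMap.ker (projSnd p q : Ambient p q →ₗ[ℝ] Ambient p q) := by
        rw [h]; trivial
      exact this
    have h3 := norm_projSnd (vecSnd p q 0)
    rw [h2] at h3
    simp at h3
  filter_upwards [measure_eq_zero_iff_ae_notMem.1 h1, measure_eq_zero_iff_ae_notMem.1 h2]
    with z hz1 hz2
  exact ⟨fun h => hz1 h, fun h => hz2 h⟩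

/-- The flow of `A` on `C_t`. -/
def flow {A : Ambient p q →L[ℝ] Ambient p q} (hA : A ∈ skewAdjoint _) (hA' : PreservesSplitting A)
    (s : ℝ) (z : clifford p q t) : clifford p q t :=
  ⟨NormedSpace.exp (s • A) z, exp_mem_clifford hA hA' s z.2⟩

/-- A rotation-invariant measure on `C_t`, a multiple of its volume measure. -/
def sphereMeasure (p q : ℕ) (t : ℝ) (hc : 0 < Real.cos t) (hs : 0 < Real.sin t) :
    Measure (clifford p q t) :=
  ((volume : Measure (Ambient p q)).restrict (Metric.ball 0 1)).map (retractionOnto p q t hc hs)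

instance isFiniteMeasure_sphereMeasure (hc : 0 < Real.cos t) (hs : 0 < Real.sin t) :
    IsFiniteMeasure (sphereMeasure p q t hc hs) := by
  have : IsFiniteMeasure ((volume : Measure (Ambient p q)).restrict (Metric.ball 0 1)) :=
    ⟨by rw [Measure.restrict_apply_univ]; exact measure_ball_lt_top⟩
  unfold sphereMeasure
  infer_instance

instance isOpenPosMeasure_sphereMeasure (hc : 0 < Real.cos t) (hs : 0 < Real.sin t) :
    (sphereMeasure p q t hc hs).IsOpenPosMeasure := by
  refine ⟨fun V hV hne => ?_⟩
  obtain ⟨O, hO, rfl⟩ := isOpen_induced_iff.1 hV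
  obtain ⟨z, hz⟩ := hne
  rw [sphereMeasure, Measure.map_apply (measurable_retractionOnto hc hs) hV.measurableSet,
    Measure.restrict_apply (measurable_retractionOnto hc hs hV.measurableSet)]
  have hopen : IsOpen (Metric.ball 0 1 ∩ (offAxes p q ∩ retraction p q t ⁻¹' O)) :=
    Metric.isOpen_ball.inter
      (contDiffOn_retraction.continuousOn.isOpen_inter_preimage isOpen_offAxes hO)
  have hoff := clifford_subset_offAxes hc.ne' hs.ne' z.2
  have hmem : (1 / 2 : ℝ) • (z : Ambient p q) ∈
      Metric.ball 0 1 ∩ (offAxes p q ∩ retraction p q t ⁻¹' O) := by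
    refine ⟨?_, ⟨?_, ?_⟩, ?_⟩
    · rw [mem_ball_zero_iff, norm_smul]
      have h1 : ‖(z : Ambient p q)‖ ^ 2 = 1 := by
        rw [WithLp.prod_norm_sq_eq_of_L2, z.2.1, z.2.2, Real.cos_sq_add_sin_sq]
      have h2 : ‖(z : Ambient p q)‖ = 1 := by
        exact (pow_eq_one_iff_of_nonneg (norm_nonneg _) two_ne_zero).1 h1
      rw [h2]; norm_num
    · rw [map_smul]; exact smul_ne_zero (by norm_num) hoff.1
    · rw [map_smul]; exact smul_ne_zero (by norm_num) hoff.2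
    · have h := retraction_smul_add_smul (t := t) (show (0 : ℝ) < 1 / 2 by norm_num)
        (show (0 : ℝ) < 1 / 2 by norm_num) (z : Ambient p q)
      rw [← smul_add, projFst_add_projSnd, retraction_of_mem hc.ne' hs.ne' z.2] at h
      rw [Set.mem_preimage, h]
      exact hz
  refine ((hopen.measure_pos volume ⟨_, hmem⟩).trans_le (measure_mono ?_)).ne'
  rintro w ⟨h1, h2, h3⟩
  refine ⟨?_, h1⟩
  rw [Set.mem_preimage, Set.mem_preimage, coe_retractionOnto hc hs h2]
  exact h3

theorem retraction_exp {A : Ambient p q →L[ℝ] Ambient p q} (hA : A ∈ skewAdjoint _)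
    (hA' : PreservesSplitting A) (s : ℝ) (z : Ambient p q) :
    retraction p q t (NormedSpace.exp (s • A) z) =
      NormedSpace.exp (s • A) (retraction p q t z) := by
  rw [retraction, retraction, map_add, map_smul, map_smul, ← projFst_exp hA', ← projSnd_exp hA']
  simp only [norm_projFst, norm_projSnd, norm_fst_exp hA hA', norm_snd_exp hA hA']

theorem measurePreserving_exp {E : Type*} [NormedAddCommGroup E] [InnerProductSpace ℝ E]
    [FiniteDimensional ℝ E] [MeasurableSpace E] [BorelSpace E] [CompleteSpace E]
    {A : E →L[ℝ] E} (hA : A ∈ skewAdjoint (E →L[ℝ] E)) (s r : ℝ) :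
    MeasurePreserving (NormedSpace.exp (s • A) : E →L[ℝ] E)
      ((volume : Measure E).restrict (Metric.ball 0 r))
      ((volume : Measure E).restrict (Metric.ball 0 r)) := by
  set R := Unitary.linearIsometryEquiv ⟨_, exp_smul_mem_unitary hA s⟩ with hR
  have h1 : ∀ z, R z = NormedSpace.exp (s • A) z := fun z => rfl
  have h := R.measurePreserving.restrict_preimage (s := Metric.ball 0 r) measurableSet_ball
  have h2 : R ⁻¹' Metric.ball 0 r = Metric.ball 0 r := by
    ext z; simp
  rw [h2] at h
  exact h

theorem measurePreserving_flow (hc : 0 < Real.cos t) (hs : 0 < Real.sin t)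
    {A : Ambient p q →L[ℝ] Ambient p q} (hA : A ∈ skewAdjoint _) (hA' : PreservesSplitting A)
    (s : ℝ) :
    MeasurePreserving (flow hA hA' s) (sphereMeasure p q t hc hs) (sphereMeasure p q t hc hs) := by
  have hm : Measurable (flow (t := t) hA hA' s) :=
    ((NormedSpace.exp (s • A) : Ambient p q →L[ℝ] Ambient p q).continuous.comp
      continuous_subtype_val).measurable.subtype_mk
  refine ⟨hm, ?_⟩
  have hp := measurePreserving_exp hA s 1
  have hr := measurable_retractionOnto (p := p) (q := q) hc hs
  unfold sphereMeasure
  rw [Measure.map_map hm hr]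
  conv_rhs => rw [← hp.map_eq, Measure.map_map hr hp.measurable]
  refine Measure.map_congr (ae_restrict_of_ae ?_)
  filter_upwards [ae_mem_offAxes] with z hz
  have hz' : NormedSpace.exp (s • A) z ∈ offAxes p q := by
    refine ⟨norm_ne_zero_iff.1 ?_, norm_ne_zero_iff.1 ?_⟩
    · rw [norm_projFst, norm_fst_exp hA hA', ← norm_projFst]; exact norm_ne_zero_iff.2 hz.1
    · rw [norm_projSnd, norm_snd_exp hA hA', ← norm_projSnd]; exact norm_ne_zero_iff.2 hz.2
  apply Subtype.ext
  simp only [Function.comp_apply]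
  rw [coe_retractionOnto hc hs hz', retraction_exp hA hA', ← coe_retractionOnto hc hs hz]
  rfl

theorem integrable_of_continuous (hc : 0 < Real.cos t) (hs : 0 < Real.sin t)
    {f : clifford p q t → ℝ} (hf : Continuous f) : Integrable f (sphereMeasure p q t hc hs) :=
  hf.integrable_of_hasCompactSupport (HasCompactSupport.of_compactSpace f)

/-- The continuous function `f` has a continuous derivative along the flow of `A`, the second of
the two given functions. -/
structure HasFlowDeriv {A : Ambient p q →L[ℝ] Ambient p q} (hA : A ∈ skewAdjoint _)
    (hA' : PreservesSplitting A) (f f' : clifford p q t → ℝ) : Prop where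
  continuous : Continuous f
  continuous_deriv : Continuous f'
  hasDerivAt : ∀ z, HasDerivAt (fun s => f (flow hA hA' s z)) (f' z) 0

section FlowDeriv

variable {A : Ambient p q →L[ℝ] Ambient p q} {hA : A ∈ skewAdjoint _}
  {hA' : PreservesSplitting A} {f f' g g' : clifford p q t → ℝ}

theorem flow_zero (z : clifford p q t) : flow hA hA' 0 z = z :=
  Subtype.ext (exp_zero_smul_apply A z)

theorem flow_add (r s : ℝ) (z : clifford p q t) :
    flow hA hA' (r + s) z = flow hA hA' s (flow hA hA' r z) :=
  Subtype.ext (exp_add_smul_apply A r s z)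

theorem HasFlowDeriv.mul (hf : HasFlowDeriv hA hA' f f') (hg : HasFlowDeriv hA hA' g g') :
    HasFlowDeriv hA hA' (fun z => f z * g z) (fun z => f' z * g z + f z * g' z) where
  continuous := hf.continuous.mul hg.continuous
  continuous_deriv :=
    (hf.continuous_deriv.mul hg.continuous).add (hf.continuous.mul hg.continuous_deriv)
  hasDerivAt z := by
    have h := (hf.hasDerivAt z).mul (hg.hasDerivAt z)
    simp only [flow_zero] at h
    exact h

theorem HasFlowDeriv.hasDerivAt_flow (hf : HasFlowDeriv hA hA' f f') (z : clifford p q t) (s : ℝ) :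
    HasDerivAt (fun s => f (flow hA hA' s z)) (f' (flow hA hA' s z)) s := by
  have h := hf.hasDerivAt (flow hA hA' s z)
  have h2 : HasDerivAt (fun r => f (flow hA hA' (r - s) (flow hA hA' s z)))
      (f' (flow hA hA' s z)) s :=
    HasDerivAt.comp_sub_const s s (by rwa [sub_self])
  refine h2.congr_of_eventuallyEq (Filter.Eventually.of_forall fun r => ?_)
  change f (flow hA hA' r z) = f (flow hA hA' (r - s) (flow hA hA' s z))
  rw [← flow_add, add_sub_cancel]

theorem HasFlowDeriv.integral_eq_zero (hc : 0 < Real.cos t) (hs : 0 < Real.sin t)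
    (hf : HasFlowDeriv hA hA' f f') : ∫ z, f' z ∂(sphereMeasure p q t hc hs) = 0 := by
  have hfl : ∀ s, Continuous (flow (t := t) hA hA' s) := fun s =>
    ((NormedSpace.exp (s • A) : Ambient p q →L[ℝ] Ambient p q).continuous.comp
      continuous_subtype_val).subtype_mk _
  obtain ⟨C, hC⟩ := isCompact_univ.exists_bound_of_continuousOn hf.continuous_deriv.continuousOn
  have h := (hasDerivAt_integral_of_dominated_loc_of_deriv_le (μ := sphereMeasure p q t hc hs)
    (F := fun s z => f (flow hA hA' s z)) (F' := fun s z => f' (flow hA hA' s z)) (x₀ := (0 : ℝ))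
    (bound := fun _ => C) (s := Set.univ) Filter.univ_mem
    (Filter.Eventually.of_forall fun s =>
      (integrable_of_continuous hc hs (hf.continuous.comp (hfl s))).aestronglyMeasurable)
    (integrable_of_continuous hc hs (hf.continuous.comp (hfl 0)))
    (integrable_of_continuous hc hs
      (hf.continuous_deriv.comp (hfl 0))).aestronglyMeasurable
    (Filter.Eventually.of_forall fun z s _ => hC _ trivial) (integrable_const C)
    (Filter.Eventually.of_forall fun z s _ => hf.hasDerivAt_flow z s)).2
  have hconst : (fun s => ∫ z, f (flow hA hA' s z) ∂(sphereMeasure p q t hc hs)) =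
      fun _ => ∫ z, f z ∂(sphereMeasure p q t hc hs) := by
    funext s
    have hmp := measurePreserving_flow hc hs hA hA' s
    conv_rhs => rw [← hmp.map_eq]
    rw [integral_map hmp.aemeasurable hf.continuous.aestronglyMeasurable]
  rw [hconst] at h
  simp only [flow_zero] at h
  exact h.unique (hasDerivAt_const _ _)

theorem HasFlowDeriv.integral_mul_comm (hc : 0 < Real.cos t) (hs : 0 < Real.sin t)
    {f'' g'' : clifford p q t → ℝ} (hf : HasFlowDeriv hA hA' f f')
    (hf' : HasFlowDeriv hA hA' f' f'')
    (hg : HasFlowDeriv hA hA' g g') (hg' : HasFlowDeriv hA hA' g' g'') :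
    ∫ z, f'' z * g z ∂(sphereMeasure p q t hc hs) =
      ∫ z, f z * g'' z ∂(sphereMeasure p q t hc hs) := by
  have h1 := (hf'.mul hg).integral_eq_zero hc hs
  have h2 := (hf.mul hg').integral_eq_zero hc hs
  rw [integral_add (integrable_of_continuous hc hs (f := fun z => f'' z * g z)
      (hf'.continuous_deriv.mul hg.continuous))
    (integrable_of_continuous hc hs (f := fun z => f' z * g' z)
      (hf'.continuous.mul hg.continuous_deriv))] at h1
  rw [integral_add (integrable_of_continuous hc hs (f := fun z => f' z * g' z)
      (hf.continuous_deriv.mul hg'.continuous))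
    (integrable_of_continuous hc hs (f := fun z => f z * g'' z)
      (hf.continuous.mul hg'.continuous_deriv))] at h2
  linarith

end FlowDeriv

end InvariantMeasure

section Moments

open MeasureTheory

variable {p q : ℕ} {t : ℝ}

section FlowDeriv

variable {A : Ambient p q →L[ℝ] Ambient p q} {hA : A ∈ skewAdjoint _}
  {hA' : PreservesSplitting A} {f f' g g' : clifford p q t → ℝ}

theorem HasFlowDeriv.add (hf : HasFlowDeriv hA hA' f f') (hg : HasFlowDeriv hA hA' g g') :
    HasFlowDeriv hA hA' (fun z => f z + g z) (fun z => f' z + g' z) where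
  continuous := hf.continuous.add hg.continuous
  continuous_deriv := hf.continuous_deriv.add hg.continuous_deriv
  hasDerivAt z := (hf.hasDerivAt z).add (hg.hasDerivAt z)

theorem HasFlowDeriv.const_mul (c : ℝ) (hf : HasFlowDeriv hA hA' f f') :
    HasFlowDeriv hA hA' (fun z => c * f z) (fun z => c * f' z) where
  continuous := continuous_const.mul hf.continuous
  continuous_deriv := continuous_const.mul hf.continuous_deriv
  hasDerivAt z := (hf.hasDerivAt z).const_mul c

theorem HasFlowDeriv.pow (hf : HasFlowDeriv hA hA' f f') (n : ℕ) :
    HasFlowDeriv hA hA' (fun z => f z ^ n) (fun z => n * f z ^ (n - 1) * f' z) where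
  continuous := hf.continuous.pow n
  continuous_deriv :=
    (continuous_const.mul (hf.continuous.pow _)).mul hf.continuous_deriv
  hasDerivAt z := by
    have h := (hf.hasDerivAt z).pow n
    simp only [flow_zero] at h
    exact h

theorem hasFlowDeriv_inner (a : Ambient p q) (B : Ambient p q →L[ℝ] Ambient p q) :
    HasFlowDeriv (t := t) hA hA' (fun z => ⟪a, B z⟫_ℝ) (fun z => ⟪a, B (A z)⟫_ℝ) where
  continuous := continuous_const.inner (B.continuous.comp continuous_subtype_val)
  continuous_deriv :=
    continuous_const.inner (B.continuous.comp (A.continuous.comp continuous_subtype_val))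
  hasDerivAt z := (innerSL ℝ a ∘L B).hasFDerivAt.comp_hasDerivAt 0
    (hasDerivAt_exp_smul_apply_zero A z)

/-- The second derivative of `⟪a, z⟫ ^ i * ⟪b, z⟫ ^ j` along the flow of `A`. -/
def monomialFlowDerivTwo (A : Ambient p q →L[ℝ] Ambient p q) (a b : Ambient p q) (i j : ℕ)
    (z : Ambient p q) : ℝ :=
  i * (i - 1 : ℕ) * ⟪a, z⟫_ℝ ^ (i - 1 - 1) * ⟪b, z⟫_ℝ ^ j * (⟪a, A z⟫_ℝ * ⟪a, A z⟫_ℝ) +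
  i * ⟪a, z⟫_ℝ ^ (i - 1) * ⟪b, z⟫_ℝ ^ j * ⟪a, A (A z)⟫_ℝ +
  2 * (i * ⟪a, z⟫_ℝ ^ (i - 1)) * (j * ⟪b, z⟫_ℝ ^ (j - 1)) * (⟪a, A z⟫_ℝ * ⟪b, A z⟫_ℝ) +
  j * (j - 1 : ℕ) * ⟪a, z⟫_ℝ ^ i * ⟪b, z⟫_ℝ ^ (j - 1 - 1) * (⟪b, A z⟫_ℝ * ⟪b, A z⟫_ℝ) +
  j * ⟪a, z⟫_ℝ ^ i * ⟪b, z⟫_ℝ ^ (j - 1) * ⟪b, A (A z)⟫_ℝ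

theorem exists_hasFlowDeriv_monomial (hA : A ∈ skewAdjoint _) (hA' : PreservesSplitting A)
    (a b : Ambient p q) (i j : ℕ) :
    ∃ g' : clifford p q t → ℝ,
      HasFlowDeriv hA hA' (fun z => ⟪a, (z : Ambient p q)⟫_ℝ ^ i * ⟪b, (z : Ambient p q)⟫_ℝ ^ j) g' ∧
      HasFlowDeriv hA hA' g' (fun z => monomialFlowDerivTwo A a b i j z) := by
  have ha : HasFlowDeriv (t := t) hA hA' (fun z => ⟪a, (z : Ambient p q)⟫_ℝ)
    (fun z => ⟪a, A z⟫_ℝ) := hasFlowDeriv_inner a (ContinuousLinearMap.id ℝ _)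
  have hb : HasFlowDeriv (t := t) hA hA' (fun z => ⟪b, (z : Ambient p q)⟫_ℝ)
    (fun z => ⟪b, A z⟫_ℝ) := hasFlowDeriv_inner b (ContinuousLinearMap.id ℝ _)
  have ha' := hasFlowDeriv_inner (t := t) (hA := hA) (hA' := hA') a A
  have hb' := hasFlowDeriv_inner (t := t) (hA := hA) (hA' := hA') b A
  refine ⟨_, (ha.pow i).mul (hb.pow j), ?_⟩
  have h := (((((ha.pow (i - 1)).const_mul i).mul ha').mul (hb.pow j))).add
    ((ha.pow i).mul (((hb.pow (j - 1)).const_mul j).mul hb'))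
  convert h using 2 with z
  unfold monomialFlowDerivTwo
  ring

end FlowDeriv

theorem sum_weight_inner_mul_inner (hc : Real.cos t ≠ 0) (hs : Real.sin t ≠ 0)
    {z : Ambient p q} (hz : z ∈ clifford p q t) (v w : Ambient p q) :
    ∑ I, weight p q t I * (⟪v, generator p q I z⟫_ℝ * ⟪w, generator p q I z⟫_ℝ) =
      ⟪v, w⟫_ℝ - ⟪v.fst, z.fst⟫_ℝ * ⟪w.fst, z.fst⟫_ℝ / Real.cos t ^ 2 -
        ⟪v.snd, z.snd⟫_ℝ * ⟪w.snd, z.snd⟫_ℝ / Real.sin t ^ 2 := by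
  have h := congrArg (fun x => ⟪x, v⟫_ℝ) (sum_weight_inner_generator_smul hc hs hz w)
  simp only [sum_inner, inner_sub_left, real_inner_smul_left, inner_projFst_left,
    inner_projSnd_left] at h
  have h1 : ∀ I, weight p q t I * (⟪v, generator p q I z⟫_ℝ * ⟪w, generator p q I z⟫_ℝ) =
      weight p q t I * (⟪generator p q I z, w⟫_ℝ * ⟪generator p q I z, v⟫_ℝ) := by
    intro I
    rw [real_inner_comm v, real_inner_comm w]; ring
  rw [Finset.sum_congr rfl fun I _ => h1 I, h, real_inner_comm v w, real_inner_comm z.fst v.fst,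
    real_inner_comm z.fst w.fst, real_inner_comm z.snd v.snd, real_inner_comm z.snd w.snd]
  ring

theorem sum_weight_inner_generator_generator (z v : Ambient p q) :
    ∑ I, weight p q t I * ⟪v, generator p q I (generator p q I z)⟫_ℝ =
      -(p / Real.cos t ^ 2 * ⟪v.fst, z.fst⟫_ℝ + q / Real.sin t ^ 2 * ⟪v.snd, z.snd⟫_ℝ) := by
  have h := congrArg (fun x => ⟪x, v⟫_ℝ) (sum_weight_generator_generator (t := t) z)
  simp only [sum_inner, inner_neg_left, inner_add_left, real_inner_smul_left, inner_projFst_left,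
    inner_projSnd_left] at h
  rw [real_inner_comm z.fst, real_inner_comm z.snd] at *
  rw [← h]
  exact Finset.sum_congr rfl fun I _ => by rw [real_inner_comm]

/-- The coefficient of `⟪a, z⟫ ^ i * ⟪b, z⟫ ^ j` in its image under the Jacobi operator. -/
def monomialCoeff (p q i j : ℕ) : ℝ :=
  (p + q) * (2 - i - j - i * (i - 1 : ℕ) / p - j * (j - 1 : ℕ) / q)

/-- The image of `⟪a, z⟫ ^ i * ⟪b, z⟫ ^ j` under the Jacobi operator, for `a` in the first and `b`
in the second factor. -/
def jacobiMonomial (a b : Ambient p q) (i j : ℕ) (z : Ambient p q) : ℝ :=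
  monomialCoeff p q i j * (⟪a, z⟫_ℝ ^ i * ⟪b, z⟫_ℝ ^ j) +
    i * (i - 1 : ℕ) * ‖a‖ ^ 2 * (⟪a, z⟫_ℝ ^ (i - 2) * ⟪b, z⟫_ℝ ^ j) +
    j * (j - 1 : ℕ) * ‖b‖ ^ 2 * (⟪a, z⟫_ℝ ^ i * ⟪b, z⟫_ℝ ^ (j - 2))

theorem natCast_mul_pow_pred_mul (x : ℝ) (i : ℕ) : (i : ℝ) * x ^ (i - 1) * x = i * x ^ i := by
  cases i with
  | zero => simp
  | succ i => rw [Nat.add_sub_cancel, pow_succ]; ring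

theorem natCast_mul_pred_mul_pow_mul (x : ℝ) (i : ℕ) :
    (i : ℝ) * (i - 1 : ℕ) * x ^ (i - 2) * (x * x) = i * (i - 1 : ℕ) * x ^ i := by
  match i with
  | 0 => simp
  | 1 => simp
  | i + 2 => simp only [Nat.add_sub_cancel]; ring

theorem sum_weight_monomialFlowDerivTwo (hp : p ≠ 0) (hq : q ≠ 0)
    (hc : Real.cos t ^ 2 = p / (p + q : ℝ)) (hs : Real.sin t ^ 2 = q / (p + q : ℝ))
    {a b : Ambient p q} (ha : a.snd = 0) (hb : b.fst = 0) (i j : ℕ)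
    {z : Ambient p q} (hz : z ∈ clifford p q t) :
    ∑ I, weight p q t I * monomialFlowDerivTwo (generator p q I) a b i j z +
      2 * (p + q) * (⟪a, z⟫_ℝ ^ i * ⟪b, z⟫_ℝ ^ j) = jacobiMonomial a b i j z := by
  have hp' : (0 : ℝ) < p := by positivity
  have hq' : (0 : ℝ) < q := by positivity
  have hc0 : Real.cos t ≠ 0 := by
    intro h; rw [h] at hc; have : (0 : ℝ) < p / (p + q) := by positivity
    simp at hc; linarith
  have hs0 : Real.sin t ≠ 0 := by
    intro h; rw [h] at hs; have : (0 : ℝ) < q / (p + q) := by positivity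
    simp at hs; linarith
  have e1 := sum_weight_inner_mul_inner hc0 hs0 hz a a
  have e2 := sum_weight_inner_mul_inner hc0 hs0 hz a b
  have e3 := sum_weight_inner_mul_inner hc0 hs0 hz b b
  have e4 := sum_weight_inner_generator_generator (t := t) z a
  have e5 := sum_weight_inner_generator_generator (t := t) z b
  have ea : ⟪a.fst, z.fst⟫_ℝ = ⟪a, z⟫_ℝ := by rw [inner_ambient, ha]; simp
  have eb : ⟪b.snd, z.snd⟫_ℝ = ⟪b, z⟫_ℝ := by rw [inner_ambient, hb]; simp
  have eab : ⟪a, b⟫_ℝ = 0 := by rw [inner_ambient, ha, hb]; simp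
  simp only [ea, eb, eab, ha, hb, inner_zero_left, mul_zero, zero_mul, zero_div, sub_zero,
    add_zero, zero_add, hc, hs, real_inner_self_eq_norm_sq] at e1 e2 e3 e4 e5
  have expand : ∑ I, weight p q t I * monomialFlowDerivTwo (generator p q I) a b i j z =
      i * (i - 1 : ℕ) * ⟪a, z⟫_ℝ ^ (i - 2) * ⟪b, z⟫_ℝ ^ j *
        (∑ I, weight p q t I * (⟪a, generator p q I z⟫_ℝ * ⟪a, generator p q I z⟫_ℝ)) +
      i * ⟪a, z⟫_ℝ ^ (i - 1) * ⟪b, z⟫_ℝ ^ j *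
        (∑ I, weight p q t I * ⟪a, generator p q I (generator p q I z)⟫_ℝ) +
      2 * (i * ⟪a, z⟫_ℝ ^ (i - 1)) * (j * ⟪b, z⟫_ℝ ^ (j - 1)) *
        (∑ I, weight p q t I * (⟪a, generator p q I z⟫_ℝ * ⟪b, generator p q I z⟫_ℝ)) +
      j * (j - 1 : ℕ) * ⟪a, z⟫_ℝ ^ i * ⟪b, z⟫_ℝ ^ (j - 2) *
        (∑ I, weight p q t I * (⟪b, generator p q I z⟫_ℝ * ⟪b, generator p q I z⟫_ℝ)) +
      j * ⟪a, z⟫_ℝ ^ i * ⟪b, z⟫_ℝ ^ (j - 1) *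
        (∑ I, weight p q t I * ⟪b, generator p q I (generator p q I z)⟫_ℝ) := by
    simp only [Finset.mul_sum, ← Finset.sum_add_distrib, monomialFlowDerivTwo, Nat.sub_sub]
    refine Finset.sum_congr rfl fun I _ => ?_
    ring
  rw [expand, e1, e2, e3, e4, e5, jacobiMonomial, monomialCoeff]
  have i1 := natCast_mul_pow_pred_mul ⟪a, z⟫_ℝ i
  have i2 := natCast_mul_pred_mul_pow_mul ⟪a, z⟫_ℝ i
  have j1 := natCast_mul_pow_pred_mul ⟪b, z⟫_ℝ j
  have j2 := natCast_mul_pred_mul_pow_mul ⟪b, z⟫_ℝ j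
  have hk1 : (p : ℝ) / (p / (p + q)) = p + q := by field_simp
  have hk2 : (q : ℝ) / (q / (p + q)) = p + q := by field_simp
  rw [hk1, hk2]
  have hk3 : ∀ x : ℝ, x / (p / (p + q) : ℝ) = (p + q) / p * x := by intro x; field_simp
  have hk4 : ∀ x : ℝ, x / (q / (p + q) : ℝ) = (p + q) / q * x := by intro x; field_simp
  rw [hk3, hk4]
  linear_combination (-(p + q : ℝ) * ⟪b, z⟫_ℝ ^ j) * i1 +
    (-((p + q : ℝ) / p) * ⟪b, z⟫_ℝ ^ j) * i2 + (-(p + q : ℝ) * ⟪a, z⟫_ℝ ^ i) * j1 +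
    (-((p + q : ℝ) / q) * ⟪a, z⟫_ℝ ^ i) * j2

theorem monomialCoeff_ne_zero (hp : p ≠ 0) (hq : q ≠ 0) {i j : ℕ} (hij : ¬(i = 1 ∧ j = 1)) :
    monomialCoeff p q i j ≠ 0 := by
  have hp' : (0 : ℝ) < p := by positivity
  have hq' : (0 : ℝ) < q := by positivity
  refine mul_ne_zero (by positivity) ?_
  have h1 : (0 : ℝ) ≤ i * (i - 1 : ℕ) / p := by positivity
  have h2 : (0 : ℝ) ≤ j * (j - 1 : ℕ) / q := by positivity
  rcases lt_trichotomy (i + j) 2 with h | h | h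
  · have : (i = 0 ∧ j = 0) ∨ (i = 1 ∧ j = 0) ∨ (i = 0 ∧ j = 1) := by omega
    rcases this with ⟨rfl, rfl⟩ | ⟨rfl, rfl⟩ | ⟨rfl, rfl⟩ <;> norm_num
  · have : (i = 2 ∧ j = 0) ∨ (i = 0 ∧ j = 2) := by omega
    rcases this with ⟨rfl, rfl⟩ | ⟨rfl, rfl⟩ <;> norm_num <;> assumption
  · have : (3 : ℝ) ≤ i + j := by exact_mod_cast h
    apply ne_of_lt
    linarith

end Moments

section JacobiFields

open MeasureTheory

variable {p q : ℕ} {t : ℝ}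

section FlowDeriv

variable {A : Ambient p q →L[ℝ] Ambient p q} {hA : A ∈ skewAdjoint _}
  {hA' : PreservesSplitting A} {f f' g' : clifford p q t → ℝ}

theorem HasFlowDeriv.unique (hf : HasFlowDeriv hA hA' f f') (hg : HasFlowDeriv hA hA' f g') :
    f' = g' :=
  funext fun z => (hf.hasDerivAt z).unique (hg.hasDerivAt z)

theorem hasFlowDeriv_sum {ι : Type*} (s : Finset ι) {F F' : ι → clifford p q t → ℝ}
    (h : ∀ i, HasFlowDeriv hA hA' (F i) (F' i)) :
    HasFlowDeriv hA hA' (fun z => ∑ i ∈ s, F i z) (fun z => ∑ i ∈ s, F' i z) where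
  continuous := continuous_finsetSum _ fun i _ => (h i).continuous
  continuous_deriv := continuous_finsetSum _ fun i _ => (h i).continuous_deriv
  hasDerivAt z := HasDerivAt.fun_sum fun i _ => (h i).hasDerivAt z

theorem hasFlowDeriv_flowDeriv (hc : 0 < Real.cos t) (hs : 0 < Real.sin t)
    {u : Ambient p q → ℝ} (hu : ContDiffOn ℝ 2 u (clifford p q t)) :
    HasFlowDeriv (t := t) hA hA' (fun z => u z) (fun z => flowDeriv p q t u A z) where
  continuous := continuousOn_iff_continuous_domRestrict.1 hu.continuousOn
  continuous_deriv :=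
    continuousOn_iff_continuous_domRestrict.1 (continuousOn_flowDeriv hc hs hu A)
  hasDerivAt z := hasDerivAt_exp_flowDeriv hc hs hu hA hA' z.2

theorem hasFlowDeriv_flowDerivTwo (hc : 0 < Real.cos t) (hs : 0 < Real.sin t)
    {u : Ambient p q → ℝ} (hu : ContDiffOn ℝ 2 u (clifford p q t)) :
    HasFlowDeriv (t := t) hA hA' (fun z => flowDeriv p q t u A z)
      (fun z => flowDerivTwo p q t u A z) where
  continuous :=
    continuousOn_iff_continuous_domRestrict.1 (continuousOn_flowDeriv hc hs hu A)
  continuous_deriv :=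
    continuousOn_iff_continuous_domRestrict.1 (continuousOn_flowDerivTwo hc hs hu A)
  hasDerivAt z := hasDerivAt_exp_flowDerivTwo hc hs hu A z.2

end FlowDeriv

/-- `C_t` is minimal: its radii satisfy `cos² t = p / (p + q)` and `sin² t = q / (p + q)`. -/
structure IsMinimalRadius (p q : ℕ) (t : ℝ) : Prop where
  left_ne_zero : p ≠ 0
  right_ne_zero : q ≠ 0
  cos_pos : 0 < Real.cos t
  sin_pos : 0 < Real.sin t
  cos_sq : Real.cos t ^ 2 = p / (p + q : ℝ)
  sin_sq : Real.sin t ^ 2 = q / (p + q : ℝ)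

theorem isMinimalRadius_of_tan_sq (hp : 1 ≤ p) (hq : 1 ≤ q)
    (ht : t ∈ Set.Ioo 0 (Real.pi / 2)) (htan : Real.tan t ^ 2 = (q : ℝ) / (p : ℝ)) :
    IsMinimalRadius p q t := by
  have hc : 0 < Real.cos t := Real.cos_pos_of_mem_Ioo ⟨by linarith [ht.1, Real.pi_pos], ht.2⟩
  have hs : 0 < Real.sin t := Real.sin_pos_of_pos_of_lt_pi ht.1 (by linarith [ht.2, Real.pi_pos])
  have hp' : (0 : ℝ) < p := by exact_mod_cast hp
  have hq' : (0 : ℝ) < q := by exact_mod_cast hq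
  rw [Real.tan_eq_sin_div_cos, div_pow, div_eq_div_iff (by positivity) hp'.ne'] at htan
  have h := Real.sin_sq_add_cos_sq t
  refine ⟨by omega, by omega, hc, hs, ?_, ?_⟩
  · rw [eq_div_iff (by positivity)]
    linear_combination (p : ℝ) * h - htan
  · rw [eq_div_iff (by positivity)]
    linear_combination (q : ℝ) * h + htan

variable {u : Ambient p q → ℝ}

theorem jacobiOperator_clifford (ht : IsMinimalRadius p q t)
    (hu : ContDiffOn ℝ 2 u (clifford p q t)) {z : Ambient p q} (hz : z ∈ clifford p q t) :
    jacobiOperator (p + q) (clifford p q t) (cliffordNormal p q t) u z =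
      ∑ I, weight p q t I * flowDerivTwo p q t u (generator p q I) z + 2 * (p + q) * u z := by
  have hp : (0 : ℝ) < p := by have := ht.left_ne_zero; positivity
  have hq : (0 : ℝ) < q := by have := ht.right_ne_zero; positivity
  rw [jacobiOperator, laplaceBeltrami_clifford ht.cos_pos ht.sin_pos hu hz,
    normSqSecondFundamentalForm_clifford ht.cos_pos.ne' ht.sin_pos.ne' hz, div_pow, div_pow,
    ht.cos_sq, ht.sin_sq]
  push_cast
  field_simp
  ring

theorem IsJacobiField.integral_mul_jacobiMonomial (ht : IsMinimalRadius p q t)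
    (hu : IsJacobiField p q t u) {a b : Ambient p q} (ha : a.snd = 0) (hb : b.fst = 0) (i j : ℕ) :
    ∫ z : clifford p q t, u z * jacobiMonomial a b i j z
      ∂(sphereMeasure p q t ht.cos_pos ht.sin_pos) = 0 := by
  obtain ⟨hu, hJ⟩ := hu
  have hc := ht.cos_pos
  have hs := ht.sin_pos
  have huc : Continuous fun z : clifford p q t => u z :=
    continuousOn_iff_continuous_domRestrict.1 hu.continuousOn
  choose g' hg' hg'' using fun I : PlaneIndex p q =>
    exists_hasFlowDeriv_monomial (t := t) (generator_mem_skewAdjoint I)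
      (preservesSplitting_generator I) a b i j
  have hgc : Continuous fun z : clifford p q t =>
      ⟪a, (z : Ambient p q)⟫_ℝ ^ i * ⟪b, (z : Ambient p q)⟫_ℝ ^ j := (hg' (.inl (0, 0))).continuous
  have hsymm : ∀ I, ∫ z : clifford p q t, flowDerivTwo p q t u (generator p q I) z *
        (⟪a, (z : Ambient p q)⟫_ℝ ^ i * ⟪b, (z : Ambient p q)⟫_ℝ ^ j)
        ∂(sphereMeasure p q t hc hs) =
      ∫ z : clifford p q t, u z * monomialFlowDerivTwo (generator p q I) a b i j z
        ∂(sphereMeasure p q t hc hs) := fun I =>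
    HasFlowDeriv.integral_mul_comm hc hs (hasFlowDeriv_flowDeriv hc hs hu)
      (hasFlowDeriv_flowDerivTwo hc hs hu) (hg' I) (hg'' I)
  have hint1 : ∀ I, Integrable (fun z : clifford p q t => weight p q t I *
      (u z * monomialFlowDerivTwo (generator p q I) a b i j z)) (sphereMeasure p q t hc hs) :=
    fun I => (integrable_of_continuous hc hs (huc.mul (hg'' I).continuous_deriv)).const_mul _
  have hint2 : ∀ I, Integrable (fun z : clifford p q t => weight p q t I *
      (flowDerivTwo p q t u (generator p q I) z *
        (⟪a, (z : Ambient p q)⟫_ℝ ^ i * ⟪b, (z : Ambient p q)⟫_ℝ ^ j)))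
      (sphereMeasure p q t hc hs) :=
    fun I => (integrable_of_continuous hc hs
      ((hasFlowDeriv_flowDerivTwo (hA := generator_mem_skewAdjoint I)
        (hA' := preservesSplitting_generator I) hc hs hu).continuous_deriv.mul hgc)).const_mul _
  have hint3 : Integrable (fun z : clifford p q t => 2 * (p + q) *
      (u z * (⟪a, (z : Ambient p q)⟫_ℝ ^ i * ⟪b, (z : Ambient p q)⟫_ℝ ^ j)))
      (sphereMeasure p q t hc hs) :=
    (integrable_of_continuous hc hs (huc.mul hgc)).const_mul _
  have e1 : ∀ z : clifford p q t, u z * jacobiMonomial a b i j z =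
      ∑ I, weight p q t I * (u z * monomialFlowDerivTwo (generator p q I) a b i j z) +
        2 * (p + q) * (u z * (⟪a, (z : Ambient p q)⟫_ℝ ^ i * ⟪b, (z : Ambient p q)⟫_ℝ ^ j)) := by
    intro z
    rw [← sum_weight_monomialFlowDerivTwo ht.left_ne_zero ht.right_ne_zero ht.cos_sq ht.sin_sq
      ha hb i j z.2, mul_add, Finset.mul_sum]
    congr 1
    · exact Finset.sum_congr rfl fun I _ => by ring
    · ring
  have e2 : ∀ z : clifford p q t, ∑ I, weight p q t I *
      (flowDerivTwo p q t u (generator p q I) z *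
        (⟪a, (z : Ambient p q)⟫_ℝ ^ i * ⟪b, (z : Ambient p q)⟫_ℝ ^ j)) +
      2 * (p + q) * (u z * (⟪a, (z : Ambient p q)⟫_ℝ ^ i * ⟪b, (z : Ambient p q)⟫_ℝ ^ j)) = 0 := by
    intro z
    have h := hJ z z.2
    rw [jacobiOperator_clifford ht hu z.2] at h
    have h2 : ∀ I, weight p q t I * (flowDerivTwo p q t u (generator p q I) z *
        (⟪a, (z : Ambient p q)⟫_ℝ ^ i * ⟪b, (z : Ambient p q)⟫_ℝ ^ j)) =
        weight p q t I * flowDerivTwo p q t u (generator p q I) z *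
        (⟪a, (z : Ambient p q)⟫_ℝ ^ i * ⟪b, (z : Ambient p q)⟫_ℝ ^ j) := fun I => by ring
    rw [Finset.sum_congr rfl fun I _ => h2 I, ← Finset.sum_mul]
    linear_combination (⟪a, (z : Ambient p q)⟫_ℝ ^ i * ⟪b, (z : Ambient p q)⟫_ℝ ^ j) * h
  have e3 := integral_congr_ae (μ := sphereMeasure p q t hc hs) (Filter.Eventually.of_forall e2)
  simp only [integral_zero] at e3
  rw [integral_add (integrable_finsetSum _ fun I _ => hint2 I) hint3,
    integral_finsetSum _ fun I _ => hint2 I] at e3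
  rw [integral_congr_ae (Filter.Eventually.of_forall e1),
    integral_add (integrable_finsetSum _ fun I _ => hint1 I) hint3,
    integral_finsetSum _ fun I _ => hint1 I, ← e3]
  congr 1
  refine Finset.sum_congr rfl fun I _ => ?_
  rw [integral_const_mul, integral_const_mul, hsymm]

/-- The bilinear function `∑ a^{kl} x_k y_l`. -/
def bilinearFun (a : Fin (p + 1) → Fin (q + 1) → ℝ) (z : Ambient p q) : ℝ :=
  ∑ k, ∑ l, a k l * z.fst k * z.snd l

theorem bilinearFun_eq (a : Fin (p + 1) → Fin (q + 1) → ℝ) (z : Ambient p q) :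
    bilinearFun a z = ∑ kl : Fin (p + 1) × Fin (q + 1), a kl.1 kl.2 *
      (⟪vecFst p q kl.1, z⟫_ℝ ^ 1 * ⟪vecSnd p q kl.2, z⟫_ℝ ^ 1) := by
  simp only [bilinearFun, Fintype.sum_prod_type, inner_vecFst, inner_vecSnd, pow_one, mul_assoc]

theorem contDiff_bilinearFun (a : Fin (p + 1) → Fin (q + 1) → ℝ) :
    ContDiff ℝ 2 (bilinearFun a : Ambient p q → ℝ) := by
  have h : (bilinearFun a : Ambient p q → ℝ) = fun z =>
    ∑ kl : Fin (p + 1) × Fin (q + 1), a kl.1 kl.2 *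
      (⟪vecFst p q kl.1, z⟫_ℝ ^ 1 * ⟪vecSnd p q kl.2, z⟫_ℝ ^ 1) := funext (bilinearFun_eq a)
  rw [h]
  exact ContDiff.sum fun kl _ => contDiff_const.mul
    (((contDiff_const.inner ℝ contDiff_id).pow 1).mul
      ((contDiff_const.inner ℝ contDiff_id).pow 1))

theorem jacobiMonomial_one_one (a b z : Ambient p q) : jacobiMonomial a b 1 1 z = 0 := by
  simp [jacobiMonomial, monomialCoeff]
  norm_num

theorem isJacobiField_of_eq_bilinearFun (ht : IsMinimalRadius p q t)
    (a : Fin (p + 1) → Fin (q + 1) → ℝ) (hu : ∀ z ∈ clifford p q t, u z = bilinearFun a z) :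
    IsJacobiField p q t u := by
  have hc := ht.cos_pos
  have hs := ht.sin_pos
  have hC : ContDiffOn ℝ 2 u (clifford p q t) := (contDiff_bilinearFun a).contDiffOn.congr hu
  refine ⟨hC, fun z hz => ?_⟩
  rw [jacobiOperator_clifford ht hC hz]
  have huM : (fun z : clifford p q t => u z) = fun z : clifford p q t =>
      ∑ kl : Fin (p + 1) × Fin (q + 1), a kl.1 kl.2 *
      (⟪vecFst p q kl.1, (z : Ambient p q)⟫_ℝ ^ 1 * ⟪vecSnd p q kl.2, (z : Ambient p q)⟫_ℝ ^ 1) := by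
    funext z
    rw [hu z z.2, bilinearFun_eq]
  have h1 : ∀ I, flowDerivTwo p q t u (generator p q I) z =
      ∑ kl : Fin (p + 1) × Fin (q + 1), a kl.1 kl.2 *
        monomialFlowDerivTwo (generator p q I) (vecFst p q kl.1) (vecSnd p q kl.2) 1 1 z := by
    intro I
    choose g' hg' hg'' using fun kl : Fin (p + 1) × Fin (q + 1) =>
      exists_hasFlowDeriv_monomial (t := t) (generator_mem_skewAdjoint I)
        (preservesSplitting_generator I) (vecFst p q kl.1) (vecSnd p q kl.2) 1 1
    have k1 := hasFlowDeriv_sum Finset.univ fun kl => (hg' kl).const_mul (a kl.1 kl.2)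
    have k2 := hasFlowDeriv_sum Finset.univ fun kl => (hg'' kl).const_mul (a kl.1 kl.2)
    have k3 := hasFlowDeriv_flowDeriv (hA := generator_mem_skewAdjoint I)
        (hA' := preservesSplitting_generator I) hc hs hC
    have k4 := hasFlowDeriv_flowDerivTwo (hA := generator_mem_skewAdjoint I)
        (hA' := preservesSplitting_generator I) hc hs hC
    rw [huM] at k3
    rw [k3.unique k1] at k4
    exact congrFun (k4.unique k2) ⟨z, hz⟩
  simp only [h1, Finset.mul_sum]
  rw [Finset.sum_comm, hu z hz, bilinearFun_eq, Finset.mul_sum, ← Finset.sum_add_distrib]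
  refine Finset.sum_eq_zero fun kl _ => ?_
  have h2 := sum_weight_monomialFlowDerivTwo ht.left_ne_zero ht.right_ne_zero ht.cos_sq ht.sin_sq
    (vecFst_snd kl.1) (vecSnd_fst kl.2) 1 1 hz
  rw [jacobiMonomial_one_one] at h2
  have h3 : ∀ I, weight p q t I * (a kl.1 kl.2 *
      monomialFlowDerivTwo (generator p q I) (vecFst p q kl.1) (vecSnd p q kl.2) 1 1 z) =
      a kl.1 kl.2 * (weight p q t I *
      monomialFlowDerivTwo (generator p q I) (vecFst p q kl.1) (vecSnd p q kl.2) 1 1 z) :=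
    fun I => by ring
  rw [Finset.sum_congr rfl fun I _ => h3 I, ← Finset.mul_sum]
  linear_combination a kl.1 kl.2 * h2

end JacobiFields

section Completeness

open MeasureTheory

/-- On a compact subset of a Euclidean space, a continuous function orthogonal to all powers of
linear functionals is zero. -/
theorem eq_zero_of_integral_mul_inner_pow_eq_zero {E : Type*} [NormedAddCommGroup E]
    [InnerProductSpace ℝ E] [MeasurableSpace E] [BorelSpace E] {K : Set E} [CompactSpace K]
    (ν : Measure K) [IsFiniteMeasure ν] [ν.IsOpenPosMeasure] (v : C(K, ℝ))
    (hv : ∀ (w : E) (k : ℕ), ∫ z, v z * ⟪w, (z : E)⟫_ℝ ^ k ∂ν = 0) : v = 0 := by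
  have hint : ∀ f : C(K, ℝ), Integrable f ν := fun f =>
    f.continuous.integrable_of_hasCompactSupport (HasCompactSupport.of_compactSpace f)
  let L₀ : C(K, ℝ) →ₗ[ℝ] ℝ :=
    { toFun := fun f => ∫ z, v z * f z ∂ν
      map_add' := fun f g => by
        exact (integral_congr_ae (Filter.Eventually.of_forall fun z => mul_add _ _ _)).trans
          (integral_add (hint (v * f)) (hint (v * g)))
      map_smul' := fun r f => by
        rw [RingHom.id_apply, smul_eq_mul, ← integral_const_mul]
        exact integral_congr_ae (Filter.Eventually.of_forall fun z => mul_left_comm _ _ _) }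
  let Λ : C(K, ℝ) →L[ℝ] ℝ := L₀.mkContinuous (‖v‖ * ν.real Set.univ) fun f => by
    have h := norm_integral_le_of_norm_le_const (μ := ν) (f := fun z => v z * f z)
      (C := ‖v‖ * ‖f‖) (Filter.Eventually.of_forall fun z => by
        rw [norm_mul]
        exact mul_le_mul (v.norm_coe_le_norm z) (f.norm_coe_le_norm z) (norm_nonneg _)
          (norm_nonneg _))
    refine h.trans (le_of_eq ?_)
    ring
  have hΛ : ∀ f, Λ f = ∫ z, v z * f z ∂ν := fun f => rfl
  let ℓ : E → C(K, ℝ) := fun w => ⟨fun z => ⟪w, (z : E)⟫_ℝ,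
    continuous_const.inner continuous_subtype_val⟩
  have hadd : ∀ w w', ℓ w + ℓ w' = ℓ (w + w') := fun w w' => by
    ext z; exact (inner_add_left _ _ _).symm
  have hzero : ℓ 0 = 0 := by
    ext z; exact inner_zero_left _
  have hexp : ∀ w, Λ (NormedSpace.exp (ℓ w)) = 0 := by
    intro w
    have h := (NormedSpace.exp_series_hasSum_exp' (𝕂 := ℝ) (ℓ w)).mapL Λ
    refine h.unique ?_
    have h0 : ∀ k : ℕ, Λ (((k.factorial : ℝ)⁻¹) • ℓ w ^ k) = 0 := by
      intro k
      rw [map_smul, hΛ]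
      exact smul_eq_zero_of_right _ (hv w k)
    simp only [h0]
    exact hasSum_zero
  let S : Submonoid C(K, ℝ) :=
    { carrier := Set.range fun w => NormedSpace.exp (ℓ w)
      one_mem' := ⟨0, by simp only [hzero, NormedSpace.exp_zero]⟩
      mul_mem' := by
        rintro _ _ ⟨w, rfl⟩ ⟨w', rfl⟩
        refine ⟨w + w', ?_⟩
        let _ : NormedAlgebra ℚ C(K, ℝ) := NormedAlgebra.restrictScalars ℚ ℝ _
        simp only [← hadd]
        exact NormedSpace.exp_add }
  let 𝒜 : Subalgebra ℝ C(K, ℝ) := Algebra.adjoin ℝ (S : Set C(K, ℝ))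
  have hker : ∀ f ∈ 𝒜, Λ f = 0 := by
    intro f hf
    have hf' : f ∈ Submodule.span ℝ (S : Set C(K, ℝ)) := by
      have := Algebra.adjoin_eq_span ℝ (S : Set C(K, ℝ))
      rw [Submonoid.closure_eq] at this
      rw [← this]
      exact hf
    have hle : Submodule.span ℝ (S : Set C(K, ℝ)) ≤ LinearMap.ker (Λ : C(K, ℝ) →ₗ[ℝ] ℝ) := by
      rw [Submodule.span_le]
      rintro _ ⟨w, rfl⟩
      exact hexp w
    exact hle hf'
  have hexpz : ∀ (w : E) (z : K), NormedSpace.exp (ℓ w) z = Real.exp ⟪w, (z : E)⟫_ℝ := by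
    intro w z
    have h := (NormedSpace.exp_series_hasSum_exp' (𝕂 := ℝ) (ℓ w)).mapL
      (ContinuousMap.evalCLM ℝ z)
    have h2 := NormedSpace.exp_series_hasSum_exp' (𝕂 := ℝ) (⟪w, (z : E)⟫_ℝ)
    rw [← Real.exp_eq_exp_ℝ] at h2
    exact h.unique h2
  have hsep : 𝒜.SeparatesPoints := by
    intro z z' hne
    refine ⟨_, ⟨NormedSpace.exp (ℓ ((z : E) - z')), Algebra.subset_adjoin ⟨_, rfl⟩, rfl⟩, ?_⟩
    change NormedSpace.exp (ℓ _) z ≠ NormedSpace.exp (ℓ _) z'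
    rw [hexpz, hexpz]
    intro h
    have h1 := Real.exp_injective h
    have h2 : ⟪(z : E) - z', (z : E) - z'⟫_ℝ = 0 := by rw [inner_sub_right, h1, sub_self]
    exact hne (Subtype.ext (sub_eq_zero.1 (inner_self_eq_zero.1 h2)))
  have hdense := ContinuousMap.subalgebra_topologicalClosure_eq_top_of_separatesPoints 𝒜 hsep
  have hvv : Λ v = 0 := by
    have hmem : v ∈ closure (𝒜 : Set C(K, ℝ)) := by
      rw [← Subalgebra.topologicalClosure_coe, hdense]
      trivial
    exact closure_minimal (fun f hf => hker f hf) (isClosed_eq Λ.continuous continuous_const) hmem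
  rw [hΛ, integral_eq_zero_iff_of_nonneg (fun z => mul_self_nonneg _) (hint (v * v))] at hvv
  have h := Measure.eq_of_ae_eq hvv (v.continuous.mul v.continuous) continuous_const
  ext z
  exact mul_self_eq_zero.1 (congrFun h z)

variable {p q : ℕ} {t : ℝ}

theorem integral_mul_monomial_eq_zero (ht : IsMinimalRadius p q t) {v : clifford p q t → ℝ}
    (hv : Continuous v) {a b : Ambient p q}
    (hJ : ∀ i j, ∫ z, v z * jacobiMonomial a b i j z
      ∂(sphereMeasure p q t ht.cos_pos ht.sin_pos) = 0)
    (h11 : ∫ z, v z * (⟪a, (z : Ambient p q)⟫_ℝ * ⟪b, (z : Ambient p q)⟫_ℝ)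
      ∂(sphereMeasure p q t ht.cos_pos ht.sin_pos) = 0) (i j : ℕ) :
    ∫ z, v z * (⟪a, (z : Ambient p q)⟫_ℝ ^ i * ⟪b, (z : Ambient p q)⟫_ℝ ^ j)
      ∂(sphereMeasure p q t ht.cos_pos ht.sin_pos) = 0 := by
  induction h : i + j using Nat.strong_induction_on generalizing i j with
  | _ n ih =>
  subst h
  by_cases hij : i = 1 ∧ j = 1
  · obtain ⟨rfl, rfl⟩ := hij
    simpa only [pow_one] using h11
  have hint : ∀ (r : ℝ) (i j : ℕ), Integrable (fun z : clifford p q t =>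
      r * (v z * (⟪a, (z : Ambient p q)⟫_ℝ ^ i * ⟪b, (z : Ambient p q)⟫_ℝ ^ j)))
      (sphereMeasure p q t ht.cos_pos ht.sin_pos) := fun r i j =>
    (integrable_of_continuous ht.cos_pos ht.sin_pos (hv.mul
      (((continuous_const.inner continuous_subtype_val).pow i).mul
        ((continuous_const.inner continuous_subtype_val).pow j)))).const_mul r
  have h0 : (i : ℝ) * (i - 1 : ℕ) * ‖a‖ ^ 2 * ∫ z : clifford p q t, v z *
      (⟪a, (z : Ambient p q)⟫_ℝ ^ (i - 2) * ⟪b, (z : Ambient p q)⟫_ℝ ^ j)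
      ∂(sphereMeasure p q t ht.cos_pos ht.sin_pos) = 0 := by
    rcases lt_or_ge i 2 with hi | hi
    · interval_cases i <;> simp
    · rw [ih (i - 2 + j) (by omega) (i - 2) j rfl, mul_zero]
  have h1 : (j : ℝ) * (j - 1 : ℕ) * ‖b‖ ^ 2 * ∫ z : clifford p q t, v z *
      (⟪a, (z : Ambient p q)⟫_ℝ ^ i * ⟪b, (z : Ambient p q)⟫_ℝ ^ (j - 2))
      ∂(sphereMeasure p q t ht.cos_pos ht.sin_pos) = 0 := by
    rcases lt_or_ge j 2 with hj | hj
    · interval_cases j <;> simp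
    · rw [ih (i + (j - 2)) (by omega) i (j - 2) rfl, mul_zero]
  have hexp : ∀ z : clifford p q t, v z * jacobiMonomial a b i j z =
      monomialCoeff p q i j *
        (v z * (⟪a, (z : Ambient p q)⟫_ℝ ^ i * ⟪b, (z : Ambient p q)⟫_ℝ ^ j)) +
      i * (i - 1 : ℕ) * ‖a‖ ^ 2 *
        (v z * (⟪a, (z : Ambient p q)⟫_ℝ ^ (i - 2) * ⟪b, (z : Ambient p q)⟫_ℝ ^ j)) +
      j * (j - 1 : ℕ) * ‖b‖ ^ 2 *
        (v z * (⟪a, (z : Ambient p q)⟫_ℝ ^ i * ⟪b, (z : Ambient p q)⟫_ℝ ^ (j - 2))) := by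
    intro z
    unfold jacobiMonomial
    ring
  have hm := hJ i j
  rw [integral_congr_ae (Filter.Eventually.of_forall hexp),
    integral_add ((hint _ _ _).fun_add (hint _ _ _)) (hint _ _ _),
    integral_add (hint _ _ _) (hint _ _ _), integral_const_mul, integral_const_mul,
    integral_const_mul, h0, h1, add_zero, add_zero] at hm
  exact (mul_eq_zero.1 hm).resolve_left
    (monomialCoeff_ne_zero ht.left_ne_zero ht.right_ne_zero hij)

theorem eq_zero_of_weak_jacobi (ht : IsMinimalRadius p q t) {v : clifford p q t → ℝ}
    (hv : Continuous v)
    (hJ : ∀ a b : Ambient p q, a.snd = 0 → b.fst = 0 → ∀ i j,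
      ∫ z, v z * jacobiMonomial a b i j z ∂(sphereMeasure p q t ht.cos_pos ht.sin_pos) = 0)
    (h11 : ∀ a b : Ambient p q, a.snd = 0 → b.fst = 0 →
      ∫ z, v z * (⟪a, (z : Ambient p q)⟫_ℝ * ⟪b, (z : Ambient p q)⟫_ℝ)
        ∂(sphereMeasure p q t ht.cos_pos ht.sin_pos) = 0) : v = 0 := by
  have h := eq_zero_of_integral_mul_inner_pow_eq_zero
    (sphereMeasure p q t ht.cos_pos ht.sin_pos) ⟨v, hv⟩ ?_
  · funext z
    exact congrArg (fun f : C(clifford p q t, ℝ) => f z) h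
  intro w k
  have h1 : ∀ z : clifford p q t, v z * ⟪w, (z : Ambient p q)⟫_ℝ ^ k =
      ∑ m ∈ Finset.range (k + 1), (k.choose m : ℝ) *
        (v z * (⟪projFst p q w, (z : Ambient p q)⟫_ℝ ^ m *
          ⟪projSnd p q w, (z : Ambient p q)⟫_ℝ ^ (k - m))) := by
    intro z
    conv_lhs => rw [← projFst_add_projSnd w, inner_add_left, add_pow, Finset.mul_sum]
    exact Finset.sum_congr rfl fun m _ => by ring
  refine (integral_congr_ae (Filter.Eventually.of_forall h1)).trans ?_
  rw [integral_finsetSum]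
  · refine Finset.sum_eq_zero fun m _ => ?_
    rw [integral_const_mul, integral_mul_monomial_eq_zero ht hv (hJ _ _ rfl rfl)
      (h11 _ _ rfl rfl), mul_zero]
  · intro m _
    exact (integrable_of_continuous ht.cos_pos ht.sin_pos (hv.mul
      (((continuous_const.inner continuous_subtype_val).pow _).mul
        ((continuous_const.inner continuous_subtype_val).pow _)))).const_mul _

theorem bilinearFun_injective_on_clifford (hc : 0 < Real.cos t) (hs : 0 < Real.sin t)
    {a : Fin (p + 1) → Fin (q + 1) → ℝ} (h : ∀ z ∈ clifford p q t, bilinearFun a z = 0) :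
    a = 0 := by
  funext k l
  have h1 := h _ (smul_vecFst_add_smul_vecSnd_mem_clifford hc hs k l)
  have h2 : bilinearFun a (Real.cos t • vecFst p q k + Real.sin t • vecSnd p q l) =
      a k l * Real.cos t * Real.sin t := by
    unfold bilinearFun
    rw [Finset.sum_eq_single k, Finset.sum_eq_single l]
    · simp
    · intro l' _ hl'; simp [hl']
    · simp
    · intro k' _ hk'; simp [hk']
    · simp
  rw [h2] at h1
  simpa [hc.ne', hs.ne'] using h1

theorem bilinearFun_add (a b : Fin (p + 1) → Fin (q + 1) → ℝ) (z : Ambient p q) :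
    bilinearFun (a + b) z = bilinearFun a z + bilinearFun b z := by
  simp only [bilinearFun, Pi.add_apply, add_mul, Finset.sum_add_distrib]

theorem bilinearFun_smul (r : ℝ) (a : Fin (p + 1) → Fin (q + 1) → ℝ) (z : Ambient p q) :
    bilinearFun (r • a) z = r * bilinearFun a z := by
  simp only [bilinearFun, Pi.smul_apply, smul_eq_mul, mul_assoc, Finset.mul_sum]

/-- Every continuous function on `C_t` agrees with some bilinear function up to a function
orthogonal to all bilinear functions. -/
theorem exists_bilinearFun_orthogonal (hc : 0 < Real.cos t) (hs : 0 < Real.sin t)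
    {u : clifford p q t → ℝ} (hu : Continuous u) :
    ∃ a : Fin (p + 1) → Fin (q + 1) → ℝ, ∀ b : Fin (p + 1) → Fin (q + 1) → ℝ,
      ∫ z, (u z - bilinearFun a (z : Ambient p q)) * bilinearFun b z
        ∂(sphereMeasure p q t hc hs) = 0 := by
  have hB : ∀ a : Fin (p + 1) → Fin (q + 1) → ℝ,
      Continuous fun z : clifford p q t => bilinearFun a (z : Ambient p q) := fun a =>
    (contDiff_bilinearFun a).continuous.comp continuous_subtype_val
  have hint : ∀ {f g : clifford p q t → ℝ}, Continuous f → Continuous g →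
      Integrable (fun z => f z * g z) (sphereMeasure p q t hc hs) := fun hf hg =>
    integrable_of_continuous hc hs (hf.mul hg)
  let Φ : (Fin (p + 1) → Fin (q + 1) → ℝ) →ₗ[ℝ] Module.Dual ℝ (Fin (p + 1) → Fin (q + 1) → ℝ) :=
    LinearMap.mk₂ ℝ (fun a b => ∫ z : clifford p q t, bilinearFun a (z : Ambient p q) *
        bilinearFun b (z : Ambient p q) ∂(sphereMeasure p q t hc hs))
      (fun a a' b => by
        simp only [bilinearFun_add, add_mul]
        exact integral_add (hint (hB a) (hB b)) (hint (hB a') (hB b)))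
      (fun r a b => by
        simp only [bilinearFun_smul, mul_assoc, integral_const_mul, smul_eq_mul])
      (fun a b b' => by
        simp only [bilinearFun_add, mul_add]
        exact integral_add (hint (hB a) (hB b)) (hint (hB a) (hB b')))
      (fun r a b => by
        simp only [bilinearFun_smul, mul_left_comm _ r, integral_const_mul, smul_eq_mul])
  have hinj : Function.Injective Φ := by
    rw [injective_iff_map_eq_zero]
    intro a ha
    have h : ∫ z : clifford p q t, bilinearFun a (z : Ambient p q) *
        bilinearFun a (z : Ambient p q) ∂(sphereMeasure p q t hc hs) = 0 :=
      congrArg (fun φ : Module.Dual ℝ (Fin (p + 1) → Fin (q + 1) → ℝ) => φ a) ha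
    rw [integral_eq_zero_iff_of_nonneg (fun z => mul_self_nonneg _) (hint (hB a) (hB a))] at h
    have h2 := Measure.eq_of_ae_eq h ((hB a).mul (hB a)) continuous_const
    exact bilinearFun_injective_on_clifford hc hs fun z hz =>
      mul_self_eq_zero.1 (congrFun h2 ⟨z, hz⟩)
  have hsurj : Function.Surjective Φ :=
    (LinearMap.injective_iff_surjective_of_finrank_eq_finrank
      Subspace.dual_finrank_eq.symm).1 hinj
  let φ : Module.Dual ℝ (Fin (p + 1) → Fin (q + 1) → ℝ) :=
    { toFun := fun b => ∫ z, u z * bilinearFun b (z : Ambient p q) ∂(sphereMeasure p q t hc hs)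
      map_add' := fun b b' => by
        simp only [bilinearFun_add, mul_add]
        exact integral_add (hint hu (hB b)) (hint hu (hB b'))
      map_smul' := fun r b => by
        simp only [bilinearFun_smul, mul_left_comm _ r, integral_const_mul, smul_eq_mul,
          RingHom.id_apply] }
  obtain ⟨a, ha⟩ := hsurj φ
  refine ⟨a, fun b => ?_⟩
  have h : ∫ z : clifford p q t, bilinearFun a (z : Ambient p q) *
        bilinearFun b (z : Ambient p q) ∂(sphereMeasure p q t hc hs) =
      ∫ z, u z * bilinearFun b (z : Ambient p q) ∂(sphereMeasure p q t hc hs) :=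
    congrArg (fun φ : Module.Dual ℝ (Fin (p + 1) → Fin (q + 1) → ℝ) => φ b) ha
  simp only [sub_mul]
  rw [integral_sub (hint hu (hB b)) (hint (hB a) (hB b)), h, sub_self]

theorem bilinearFun_mul_coord {a b : Ambient p q} (ha : a.snd = 0) (hb : b.fst = 0)
    (z : Ambient p q) :
    bilinearFun (fun k l => a.fst k * b.snd l) z = ⟪a, z⟫_ℝ * ⟪b, z⟫_ℝ := by
  rw [inner_ambient, inner_ambient, ha, hb, inner_zero_left, inner_zero_left, add_zero, zero_add,
    PiLp.inner_apply, PiLp.inner_apply, Finset.sum_mul_sum]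
  refine Finset.sum_congr rfl fun k _ => Finset.sum_congr rfl fun l _ => ?_
  simp only [RCLike.inner_apply, conj_trivial]
  ring

theorem continuous_jacobiMonomial (a b : Ambient p q) (i j : ℕ) :
    Continuous (jacobiMonomial a b i j) := by
  have h : ∀ (c : Ambient p q) (k : ℕ), Continuous fun z => ⟪c, z⟫_ℝ ^ k := fun c k =>
    (continuous_const.inner continuous_id).pow k
  exact ((continuous_const.mul ((h a _).mul (h b _))).add
    (continuous_const.mul ((h a _).mul (h b _)))).add
    (continuous_const.mul ((h a _).mul (h b _)))

theorem isJacobiField_iff_bilinearFun (ht : IsMinimalRadius p q t) (u : Ambient p q → ℝ) :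
    IsJacobiField p q t u ↔ ∃ a : Fin (p + 1) → Fin (q + 1) → ℝ,
      ∀ z ∈ clifford p q t, u z = bilinearFun a z := by
  refine ⟨fun hu => ?_, fun ⟨a, ha⟩ => isJacobiField_of_eq_bilinearFun ht a ha⟩
  have huc : Continuous fun z : clifford p q t => u z :=
    continuousOn_iff_continuous_domRestrict.1 hu.1.continuousOn
  obtain ⟨a, ha⟩ := exists_bilinearFun_orthogonal ht.cos_pos ht.sin_pos huc
  have hBJ : IsJacobiField p q t (bilinearFun a) :=
    isJacobiField_of_eq_bilinearFun ht a fun z _ => rfl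
  have hBc : Continuous fun z : clifford p q t => bilinearFun a (z : Ambient p q) :=
    (contDiff_bilinearFun a).continuous.comp continuous_subtype_val
  have h := eq_zero_of_weak_jacobi ht (huc.sub hBc) ?_ ?_
  · exact ⟨a, fun z hz => sub_eq_zero.1 (congrFun h ⟨z, hz⟩)⟩
  · intro c d hcs hd i j
    have hjc := (continuous_jacobiMonomial c d i j).comp
      (continuous_subtype_val (p := fun z => z ∈ clifford p q t))
    refine (integral_congr_ae (Filter.Eventually.of_forall fun z => sub_mul _ _ _)).trans ?_
    refine (integral_sub (integrable_of_continuous ht.cos_pos ht.sin_pos (huc.mul hjc))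
      (integrable_of_continuous ht.cos_pos ht.sin_pos (hBc.mul hjc))).trans ?_
    exact sub_eq_zero.2 ((hu.integral_mul_jacobiMonomial ht hcs hd i j).trans
      (hBJ.integral_mul_jacobiMonomial ht hcs hd i j).symm)
  · intro c d hcs hd
    have h := ha fun k l => c.fst k * d.snd l
    simp only [bilinearFun_mul_coord hcs hd] at h
    exact h

end Completeness

section Rotations

variable {p q : ℕ} {t : ℝ}

/-- The coefficients of the bilinear function `⟨V, N⟩` of the infinitesimal rotation `A`. -/
def rotationCoeff (t : ℝ) (A : Ambient p q →L[ℝ] Ambient p q) (k : Fin (p + 1))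
    (l : Fin (q + 1)) : ℝ :=
  -(Real.sin t / Real.cos t + Real.cos t / Real.sin t) * ⟪A (vecFst p q k), vecSnd p q l⟫_ℝ

theorem inner_map_projFst_projSnd (A : Ambient p q →L[ℝ] Ambient p q) (z : Ambient p q) :
    ⟪A (projFst p q z), projSnd p q z⟫_ℝ =
      bilinearFun (fun k l => ⟪A (vecFst p q k), vecSnd p q l⟫_ℝ) z := by
  rw [← sum_smul_vecFst, ← sum_smul_vecSnd, map_sum, sum_inner]
  refine Finset.sum_congr rfl fun k _ => ?_
  rw [inner_sum]
  refine Finset.sum_congr rfl fun l _ => ?_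
  rw [map_smul, real_inner_smul_left, real_inner_smul_right]
  ring

theorem rotationField_eq_bilinearFun {A : Ambient p q →L[ℝ] Ambient p q}
    (hA : A ∈ skewAdjoint (Ambient p q →L[ℝ] Ambient p q)) (z : Ambient p q) :
    rotationField p q t A z = bilinearFun (rotationCoeff t A) z := by
  have h1 : bilinearFun (rotationCoeff t A) z =
      -(Real.sin t / Real.cos t + Real.cos t / Real.sin t) *
        ⟪A (projFst p q z), projSnd p q z⟫_ℝ := by
    rw [inner_map_projFst_projSnd, ← bilinearFun_smul]
    rfl
  have h2 : rotationField p q t A z = ⟪A z, cliffordNormal p q t z⟫_ℝ := by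
    rw [rotationField, (hasDerivAt_exp_smul_apply_zero A z).deriv]
  have h3 : cliffordNormal p q t z = (Real.sin t / Real.cos t) • projFst p q z -
      (Real.cos t / Real.sin t) • projSnd p q z := cliffordNormal_eq z
  have h4 : A z = A (projFst p q z) + A (projSnd p q z) := by
    rw [← map_add, projFst_add_projSnd]
  have h5 : ⟪A (projSnd p q z), projFst p q z⟫_ℝ = -⟪A (projFst p q z), projSnd p q z⟫_ℝ := by
    rw [mem_skewAdjoint_iff_inner.1 hA, real_inner_comm]
  rw [h1, h2, h3, h4]
  simp only [inner_add_left, inner_sub_right, real_inner_smul_right, h5,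
    inner_apply_self_of_skewAdjoint hA]
  ring

theorem BreaksSplitting.sum {ι : Type*} (s : Finset ι)
    {A : ι → Ambient p q →L[ℝ] Ambient p q} (h : ∀ i, BreaksSplitting (A i)) :
    BreaksSplitting (∑ i ∈ s, A i) := by
  constructor <;> intro z hz
  · have h1 := map_sum (WithLp.fstL 2 ℝ (EuclideanSpace ℝ (Fin (p + 1)))
      (EuclideanSpace ℝ (Fin (q + 1)))) (fun i => A i z) s
    rw [sum_apply]
    exact h1.trans (Finset.sum_eq_zero fun i _ => (h i).1 z hz)
  · have h1 := map_sum (WithLp.sndL 2 ℝ (EuclideanSpace ℝ (Fin (p + 1)))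
      (EuclideanSpace ℝ (Fin (q + 1)))) (fun i => A i z) s
    rw [sum_apply]
    exact h1.trans (Finset.sum_eq_zero fun i _ => (h i).2 z hz)

theorem breaksSplitting_smul_planeRotation (r : ℝ) (k : Fin (p + 1)) (l : Fin (q + 1)) :
    BreaksSplitting (r • planeRotation (vecFst p q k) (vecSnd p q l)) := by
  constructor <;> intro z hz
  · simp [hz]
  · simp [hz]

theorem exists_breaksSplitting_rotationCoeff (hc : 0 < Real.cos t) (hs : 0 < Real.sin t)
    (a : Fin (p + 1) → Fin (q + 1) → ℝ) :
    ∃ A ∈ skewAdjoint (Ambient p q →L[ℝ] Ambient p q),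
      BreaksSplitting A ∧ rotationCoeff t A = a := by
  set r := -(Real.sin t / Real.cos t + Real.cos t / Real.sin t) with hr
  have hr0 : r ≠ 0 := by rw [hr]; exact (neg_lt_zero.2 (by positivity)).ne
  refine ⟨∑ kl : Fin (p + 1) × Fin (q + 1), (r⁻¹ * a kl.1 kl.2) •
    planeRotation (vecFst p q kl.1) (vecSnd p q kl.2), ?_,
    BreaksSplitting.sum _ fun kl => breaksSplitting_smul_planeRotation _ _ _, ?_⟩
  · exact sum_mem fun kl _ => skewAdjoint.smul_mem _ (planeRotation_mem_skewAdjoint _ _)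
  · funext k l
    have h : ∀ kl : Fin (p + 1) × Fin (q + 1),
        ⟪((r⁻¹ * a kl.1 kl.2) • planeRotation (vecFst p q kl.1) (vecSnd p q kl.2)) (vecFst p q k),
          vecSnd p q l⟫_ℝ = if kl = (k, l) then r⁻¹ * a k l else 0 := by
      rintro ⟨k', l'⟩
      have h1 := orthonormal_iff_ite.1 (orthonormal_vecFst (p := p) (q := q)) k' k
      have h2 := orthonormal_iff_ite.1 (orthonormal_vecSnd (p := p) (q := q)) l' l
      have h3 : ⟪vecSnd p q l', vecFst p q k⟫_ℝ = 0 := by rw [inner_vecSnd]; simp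
      rw [smul_apply, planeRotation_apply, h3, zero_smul, sub_zero,
        real_inner_smul_left, real_inner_smul_left, h1, h2]
      by_cases hk : k' = k
      · by_cases hl : l' = l
        · simp [hk, hl]
        · simp [hl]
      · simp [hk]
    rw [rotationCoeff, sum_apply, sum_inner,
      Finset.sum_congr rfl fun kl _ => h kl, Finset.sum_ite_eq' Finset.univ (k, l),
      if_pos (Finset.mem_univ _), ← hr, mul_inv_cancel_left₀ hr0]

theorem preservesSplitting_iff_rotationCoeff (hc : 0 < Real.cos t) (hs : 0 < Real.sin t)
    {A : Ambient p q →L[ℝ] Ambient p q}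
    (hA : A ∈ skewAdjoint (Ambient p q →L[ℝ] Ambient p q)) :
    PreservesSplitting A ↔ rotationCoeff t A = 0 := by
  have hr0 : -(Real.sin t / Real.cos t + Real.cos t / Real.sin t) ≠ 0 :=
    (neg_lt_zero.2 (by positivity)).ne
  constructor
  · intro h
    funext k l
    rw [rotationCoeff, real_inner_comm, inner_vecSnd, h.1 _ (vecFst_snd k)]
    simp
  · intro h
    have h0 : ∀ k l, ⟪A (vecFst p q k), vecSnd p q l⟫_ℝ = 0 := fun k l =>
      (mul_eq_zero.1 (congrFun (congrFun h k) l)).resolve_left hr0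
    constructor <;> intro z hz
    · ext l
      have hz' : z = projFst p q z := ambient_ext rfl hz
      rw [← inner_vecSnd, hz', ← sum_smul_vecFst, map_sum, inner_sum]
      refine Finset.sum_eq_zero fun k _ => ?_
      rw [map_smul, real_inner_smul_right, real_inner_comm, h0, mul_zero]
    · ext k
      have hz' : z = projSnd p q z := ambient_ext hz rfl
      rw [← inner_vecFst, real_inner_comm, mem_skewAdjoint_iff_inner.1 hA, real_inner_comm, hz',
        ← sum_smul_vecSnd, inner_sum]
      refine neg_eq_zero.2 (Finset.sum_eq_zero fun l _ => ?_)
      rw [real_inner_smul_right, h0, mul_zero]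

theorem finrank_span_jacobiFields (ht : IsMinimalRadius p q t) :
    Module.finrank ℝ (Submodule.span ℝ ((clifford p q t).domRestrict ''
      {u : Ambient p q → ℝ | IsJacobiField p q t u})) = (p + 1) * (q + 1) := by
  let Φ : (Fin (p + 1) → Fin (q + 1) → ℝ) →ₗ[ℝ] (clifford p q t → ℝ) :=
    { toFun := fun a z => bilinearFun a (z : Ambient p q)
      map_add' := fun a b => funext fun z => bilinearFun_add a b z
      map_smul' := fun r a => funext fun z => bilinearFun_smul r a z }
  have hinj : Function.Injective Φ := by
    rw [injective_iff_map_eq_zero]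
    exact fun a ha => bilinearFun_injective_on_clifford ht.cos_pos ht.sin_pos fun z hz =>
      congrFun ha ⟨z, hz⟩
  have himg : (clifford p q t).domRestrict '' {u : Ambient p q → ℝ | IsJacobiField p q t u} =
      (LinearMap.range Φ : Set (clifford p q t → ℝ)) := by
    ext f
    constructor
    · rintro ⟨u, hu, rfl⟩
      obtain ⟨a, ha⟩ := (isJacobiField_iff_bilinearFun ht u).1 hu
      exact ⟨a, funext fun z => (ha z z.2).symm⟩
    · rintro ⟨a, rfl⟩
      exact ⟨bilinearFun a, isJacobiField_of_eq_bilinearFun ht a fun z _ => rfl, rfl⟩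
  rw [himg, Submodule.span_eq, LinearMap.finrank_range_of_inj hinj]
  simp [Module.finrank_pi_fintype]

end Rotations

end

end CliffordJacobi

theorem proposition2 (p q : ℕ) (hp : 1 ≤ p) (hq : 1 ≤ q) (t : ℝ)
    (ht : t ∈ Set.Ioo 0 (Real.pi / 2)) (htan : Real.tan t ^ 2 = (q : ℝ) / (p : ℝ)) :
    (∀ u : CliffordJacobi.Ambient p q → ℝ,
      CliffordJacobi.IsJacobiField p q t u ↔
        ∃ a : Fin (p + 1) → Fin (q + 1) → ℝ, ∀ z ∈ CliffordJacobi.clifford p q t,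
          u z = ∑ k, ∑ l, a k l * z.fst k * z.snd l) ∧
    (∀ u : CliffordJacobi.Ambient p q → ℝ,
      CliffordJacobi.IsJacobiField p q t u ↔
        ∃ A ∈ skewAdjoint (CliffordJacobi.Ambient p q →L[ℝ] CliffordJacobi.Ambient p q),
          CliffordJacobi.BreaksSplitting A ∧
            ∀ z ∈ CliffordJacobi.clifford p q t, u z = CliffordJacobi.rotationField p q t A z) ∧
    (∀ A ∈ skewAdjoint (CliffordJacobi.Ambient p q →L[ℝ] CliffordJacobi.Ambient p q),
      (∀ z ∈ CliffordJacobi.clifford p q t, CliffordJacobi.rotationField p q t A z = 0) ↔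
        CliffordJacobi.PreservesSplitting A) ∧
    Module.finrank ℝ
      (Submodule.span ℝ ((CliffordJacobi.clifford p q t).domRestrict ''
        {u : CliffordJacobi.Ambient p q → ℝ | CliffordJacobi.IsJacobiField p q t u})) =
      (p + 1) * (q + 1) := by
  have hmin := CliffordJacobi.isMinimalRadius_of_tan_sq hp hq ht htan
  refine ⟨CliffordJacobi.isJacobiField_iff_bilinearFun hmin, fun u => ?_, fun A hA => ?_,
    CliffordJacobi.finrank_span_jacobiFields hmin⟩
  · rw [CliffordJacobi.isJacobiField_iff_bilinearFun hmin]
    constructor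
    · rintro ⟨a, ha⟩
      obtain ⟨A, hA, hb, rfl⟩ := CliffordJacobi.exists_breaksSplitting_rotationCoeff
        hmin.cos_pos hmin.sin_pos a
      exact ⟨A, hA, hb, fun z hz =>
        (ha z hz).trans (CliffordJacobi.rotationField_eq_bilinearFun hA z).symm⟩
    · rintro ⟨A, hA, -, h⟩
      exact ⟨_, fun z hz => (h z hz).trans (CliffordJacobi.rotationField_eq_bilinearFun hA z)⟩
  · rw [CliffordJacobi.preservesSplitting_iff_rotationCoeff hmin.cos_pos hmin.sin_pos hA]
    simp only [CliffordJacobi.rotationField_eq_bilinearFun hA]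
    refine ⟨CliffordJacobi.bilinearFun_injective_on_clifford hmin.cos_pos hmin.sin_pos,
      fun h z _ => ?_⟩
    rw [h]
    simp [CliffordJacobi.bilinearFun]
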